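/- Fix a positive integer $c$ and $\hbar,\mu,\nu\in\mathbb R$ with $\mu^2+\nu^2\neq 0$; write $\mathbb T=\mathbb R/\mathbb Z$ and $e(t)=e^{2\pi i t}$. Let $S^c$ be the space of $C^\infty$ functions $\Phi:\mathbb R\times\mathbb T\times\mathbb Z\to\mathbb C$ such that (a) $\Phi(x+k,y,p)=e(ckpy)\,\Phi(x,y,p)$ for all $k\in\mathbb Z$, and (b) for every polynomial $P$ on $\mathbb Z$, all $m,n\ge 0$ and every compact $K\subset\mathbb R\times\mathbb T$, the function $P(p)\,\partial_x^m\partial_y^n\Phi(x,y,p)$ is bounded on $K\times\mathbb Z$. Let $\Phi^*(x,y,p)=\overline{\Phi(x,y,-p)}$, and let $\pi(\Phi)$ be the bounded operator on $L^2(\mathbb R\times\mathbb T\times\mathbb Z)$ given by $$(\pi(\Phi)\xi)(x,y,p)=\sum_{q}\Phi\big(x-\hbar(q-2p)\mu,\;y-\hbar(q-2p)\nu,\;q\big)\,\xi(x,y,p-q).$$ The norm closure of $\pi(S^c)$ is the quantum Heisenberg manifold; let $\|\Phi\|:=\|\pi(\Phi)\|$ denote the C*-norm. Let $A=S^c_{s.a.}=\{\phi\in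 S^c:\phi^*=\phi\}$, a real vector space ordered by $\phi\le\psi$ iff $\pi(\psi)-\pi(\phi)$ is a positive operator, with unit $I(x,y,p)=\delta_{p,0}$ (so that $\pi(I)=1$). Put $$\delta_1\phi=-\frac{\partial\phi}{\partial x},\qquad \delta_2\phi=2\pi i\,c\,p\,x\,\phi-\frac{\partial\phi}{\partial y},\qquad \delta_3\phi=2\pi i\,p\,\phi,$$ $$\|\Phi\|_{\infty,\infty,1}=\sum_{p\in\mathbb Z}\ \sup_{x\in\mathbb R,\,y\in\mathbb T}|\Phi(x,y,p)|,\qquad L(\phi)=\max_{1\le i\le 3}\|\delta_i(\phi)\|_{\infty,\infty,1}\quad(\phi\in A).$$ **Proposition.** $(A,I)$ is an (archimedean) order unit space, $L(\phi)<\infty$ for all $\phi\in A$, and $L:A\to\mathbb R_+$ is a Lip norm on $(A,I)$. That is: 1. $L$ is a seminorm, and $L(\phi)=0$ if and only if $\phi\in\mathbb R I$. 2. Let $S(A)$ be the set of states, i.e. of linear functionals $f:A\to\mathbb R$ with $f(I)=1$ whose dual norm with respect to the order unit norm $\inf\{r:-rI\le a\le rI\}$ is $1$. Then $$\rho_L(f,g)=\sup\{|f(a)-g(a)|: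 a\in A,\ L(a)\le 1\}$$ is a (finite) metric on $S(A)$, and its topology is the $w^*$-topology (pointwise convergence on $A$). Moreover, the set $\{\phi\in A: L(\phi)\le 1,\ \|\phi\|\le 1\}$ is totally bounded in the C*-norm. -/

import Mathlib

open MeasureTheory Topology
open scoped ENNReal ContDiff ComplexConjugate

/-! ## Order unit spaces, states and Lip norms -/

section OrderUnit

variable {A : Type*} [AddCommGroup A] [Module ℝ A] [Preorder A]

/-- `(A, e)` is an order unit space: `A` is a partially ordered real vector space, `e` is an order
unit, and the order is archimedean. -/
structure IsOrderUnitSpace (e : A) : Prop where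
  antisymm : ∀ a b : A, a ≤ b → b ≤ a → a = b
  add_le_add : ∀ a b c : A, a ≤ b → a + c ≤ b + c
  smul_le_smul : ∀ (a b : A) (r : ℝ), 0 ≤ r → a ≤ b → r • a ≤ r • b
  order_unit : ∀ a : A, ∃ r : ℝ, a ≤ r • e
  archimedean : ∀ a : A, (∀ r : ℝ, 0 < r → a ≤ r • e) → a ≤ 0

/-- The order unit norm `‖a‖ = inf {r | -r e ≤ a ≤ r e}`. -/
noncomputable def orderUnitNorm (e a : A) : ℝ :=
  sInf {r : ℝ | -(r • e) ≤ a ∧ a ≤ r • e}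

/-- A state: a linear functional `f` with `f e = 1` whose dual norm, with respect to the order unit
norm, is (finite and) equal to `1`. -/
def IsState (e : A) (f : A →ₗ[ℝ] ℝ) : Prop :=
  f e = 1 ∧ IsLUB {s : ℝ | ∃ a : A, orderUnitNorm e a ≤ 1 ∧ s = |f a|} 1

/-- The state space `S(A)`. -/
def StateSpace (e : A) : Type _ := {f : A →ₗ[ℝ] ℝ // IsState e f}

/-- The `w*`-topology on the state space, i.e. the topology of pointwise convergence on `A`. -/
abbrev weakStarTopology (e : A) : TopologicalSpace (StateSpace e) :=
  TopologicalSpace.induced (fun (f : StateSpace e) (a : A) => f.1 a) Pi.topologicalSpace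

/-- A Lip norm on `(A, e)`: a seminorm `L` vanishing exactly on `ℝ e`, such that
`ρ_L(f, g) = sup {|f a - g a| : L a ≤ 1}` is a (finite) metric on the state space
inducing the `w*`-topology. -/
structure IsLipNorm (e : A) (L : A → ℝ) : Prop where
  nonneg : ∀ a, 0 ≤ L a
  add_le : ∀ a b, L (a + b) ≤ L a + L b
  smul : ∀ (r : ℝ) (a : A), L (r • a) = |r| * L a
  eq_zero_iff : ∀ a, L a = 0 ↔ ∃ r : ℝ, a = r • e
  metrizes : ∃ d : MetricSpace (StateSpace e),
    (∀ f g : StateSpace e,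
      IsLUB {s : ℝ | ∃ a : A, L a ≤ 1 ∧ s = |f.1 a - g.1 a|} (d.dist f g)) ∧
    d.toUniformSpace.toTopologicalSpace = weakStarTopology e

end OrderUnit

namespace QHM

/-! ## The space `S^c` -/

/-- Functions `Φ(x, y, p)` on `ℝ × 𝕋 × ℤ`, where `𝕋 = ℝ/ℤ`. -/
abbrev Fn : Type := ℝ → UnitAddCircle → ℤ → ℂ

/-- `∂Φ/∂x`. -/
noncomputable def dx (Φ : Fn) : Fn := fun x y p => deriv (fun t : ℝ => Φ t y p) x

/-- `∂Φ/∂y`. -/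
noncomputable def dy (Φ : Fn) : Fn :=
  fun x y p => deriv (fun t : ℝ => Φ x (y + (t : UnitAddCircle)) p) 0

/-- The lift of `Φ(·, ·, p)` to `ℝ × ℝ`. -/
def lift (Φ : Fn) (p : ℤ) : ℝ × ℝ → ℂ := fun v => Φ v.1 (v.2 : UnitAddCircle) p

/-- Membership in `S^c`. Here `fourier n y = e(n y)` is the character `e(t) = exp (2 π i t)`. -/
structure IsSc (c : ℕ) (Φ : Fn) : Prop where
  smooth : ∀ p : ℤ, ContDiff ℝ ∞ (lift Φ p)
  quasiperiodic : ∀ (k : ℤ) (x : ℝ) (y : UnitAddCircle) (p : ℤ),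
    Φ (x + k) y p = fourier ((c : ℤ) * k * p) y * Φ x y p
  decay : ∀ (P : Polynomial ℂ) (m n : ℕ) (K : Set (ℝ × UnitAddCircle)), IsCompact K →
    ∃ C : ℝ, ∀ v ∈ K, ∀ p : ℤ, ‖P.eval (p : ℂ) * (dx^[m] (dy^[n] Φ)) v.1 v.2 p‖ ≤ C

section closure

theorem lift_dx {Φ : Fn} {p : ℤ} (h : ContDiff ℝ ∞ (lift Φ p)) :
    lift (dx Φ) p = fun v => fderiv ℝ (lift Φ p) v (1, 0) := by
  funext v
  have h1 : HasFDerivAt (lift Φ p) (fderiv ℝ (lift Φ p) v) v :=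
    (h.differentiable (by simp) v).hasFDerivAt
  have h2 : HasDerivAt (fun t : ℝ => ((t, v.2) : ℝ × ℝ)) (1, 0) v.1 :=
    (hasDerivAt_id v.1).prodMk (hasDerivAt_const v.1 v.2)
  exact (HasFDerivAt.comp_hasDerivAt (x := v.1) (f := fun t : ℝ => ((t, v.2) : ℝ × ℝ)) h1 h2).deriv

theorem lift_dy {Φ : Fn} {p : ℤ} (h : ContDiff ℝ ∞ (lift Φ p)) :
    lift (dy Φ) p = fun v => fderiv ℝ (lift Φ p) v (0, 1) := by
  funext v
  have h1 : HasFDerivAt (lift Φ p) (fderiv ℝ (lift Φ p) v) (v.1, v.2 + 0) := by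
    simpa using (h.differentiable (by simp) v).hasFDerivAt
  have h2 : HasDerivAt (fun t : ℝ => ((v.1, v.2 + t) : ℝ × ℝ)) (0, 1) 0 :=
    (hasDerivAt_const 0 v.1).prodMk ((hasDerivAt_id (0 : ℝ)).const_add v.2)
  have h3 := (HasFDerivAt.comp_hasDerivAt (x := (0 : ℝ))
    (f := fun t : ℝ => ((v.1, v.2 + t) : ℝ × ℝ)) h1 h2).deriv
  rw [← h3]
  rfl

theorem smooth_dx {Φ : Fn} (h : ∀ p, ContDiff ℝ ∞ (lift Φ p)) (p : ℤ) :
    ContDiff ℝ ∞ (lift (dx Φ) p) := by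
  rw [lift_dx (h p)]
  exact ((h p).fderiv_right (m := ∞) (by simp)).clm_apply contDiff_const

theorem smooth_dy {Φ : Fn} (h : ∀ p, ContDiff ℝ ∞ (lift Φ p)) (p : ℤ) :
    ContDiff ℝ ∞ (lift (dy Φ) p) := by
  rw [lift_dy (h p)]
  exact ((h p).fderiv_right (m := ∞) (by simp)).clm_apply contDiff_const

theorem fn_ext {Φ Ψ : Fn} (h : ∀ p, lift Φ p = lift Ψ p) : Φ = Ψ := by
  funext x y p
  obtain ⟨t, rfl⟩ := QuotientAddGroup.mk_surjective y
  exact congrFun (h p) (x, t)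

theorem smooth_add {Φ Ψ : Fn} (h : ∀ p, ContDiff ℝ ∞ (lift Φ p))
    (h' : ∀ p, ContDiff ℝ ∞ (lift Ψ p)) (p : ℤ) : ContDiff ℝ ∞ (lift (Φ + Ψ) p) :=
  (h p).add (h' p)

theorem smooth_smul {Φ : Fn} (a : ℂ) (h : ∀ p, ContDiff ℝ ∞ (lift Φ p)) (p : ℤ) :
    ContDiff ℝ ∞ (lift (a • Φ) p) :=
  (h p).const_smul a

theorem dx_add {Φ Ψ : Fn} (h : ∀ p, ContDiff ℝ ∞ (lift Φ p))
    (h' : ∀ p, ContDiff ℝ ∞ (lift Ψ p)) : dx (Φ + Ψ) = dx Φ + dx Ψ := by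
  refine fn_ext fun p => ?_
  rw [lift_dx (smooth_add h h' p)]
  funext v
  have e : lift (Φ + Ψ) p = lift Φ p + lift Ψ p := rfl
  rw [e, fderiv_add ((h p).differentiable (by simp) v) ((h' p).differentiable (by simp) v)]
  have e1 := congrFun (lift_dx (h p)) v
  have e2 := congrFun (lift_dx (h' p)) v
  simp only [add_apply, ← e1, ← e2]
  rfl

theorem dy_add {Φ Ψ : Fn} (h : ∀ p, ContDiff ℝ ∞ (lift Φ p))
    (h' : ∀ p, ContDiff ℝ ∞ (lift Ψ p)) : dy (Φ + Ψ) = dy Φ + dy Ψ := by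
  refine fn_ext fun p => ?_
  rw [lift_dy (smooth_add h h' p)]
  funext v
  have e : lift (Φ + Ψ) p = lift Φ p + lift Ψ p := rfl
  rw [e, fderiv_add ((h p).differentiable (by simp) v) ((h' p).differentiable (by simp) v)]
  have e1 := congrFun (lift_dy (h p)) v
  have e2 := congrFun (lift_dy (h' p)) v
  simp only [add_apply, ← e1, ← e2]
  rfl

theorem dx_smul (a : ℂ) (Φ : Fn) : dx (a • Φ) = a • dx Φ := by
  funext x y p
  exact deriv_const_mul_field (v := fun t : ℝ => Φ t y p) a

theorem dy_smul (a : ℂ) (Φ : Fn) : dy (a • Φ) = a • dy Φ := by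
  funext x y p
  exact deriv_const_mul_field (v := fun t : ℝ => Φ x (y + (t : UnitAddCircle)) p) a

theorem smooth_iter_dy {Φ : Fn} (h : ∀ p, ContDiff ℝ ∞ (lift Φ p)) (n : ℕ) :
    ∀ p, ContDiff ℝ ∞ (lift (dy^[n] Φ) p) := by
  induction n with
  | zero => simpa using h
  | succ n ih => rw [Function.iterate_succ_apply']; exact smooth_dy ih

theorem smooth_iter_dx {Φ : Fn} (h : ∀ p, ContDiff ℝ ∞ (lift Φ p)) (n : ℕ) :
    ∀ p, ContDiff ℝ ∞ (lift (dx^[n] Φ) p) := by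
  induction n with
  | zero => simpa using h
  | succ n ih => rw [Function.iterate_succ_apply']; exact smooth_dx ih

theorem iter_dx_add {Φ Ψ : Fn} (h : ∀ p, ContDiff ℝ ∞ (lift Φ p))
    (h' : ∀ p, ContDiff ℝ ∞ (lift Ψ p)) (n : ℕ) :
    dx^[n] (Φ + Ψ) = dx^[n] Φ + dx^[n] Ψ := by
  induction n with
  | zero => rfl
  | succ n ih =>
    simp only [Function.iterate_succ_apply', ih]
    exact dx_add (smooth_iter_dx h n) (smooth_iter_dx h' n)

theorem iter_dy_add {Φ Ψ : Fn} (h : ∀ p, ContDiff ℝ ∞ (lift Φ p))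
    (h' : ∀ p, ContDiff ℝ ∞ (lift Ψ p)) (n : ℕ) :
    dy^[n] (Φ + Ψ) = dy^[n] Φ + dy^[n] Ψ := by
  induction n with
  | zero => rfl
  | succ n ih =>
    simp only [Function.iterate_succ_apply', ih]
    exact dy_add (smooth_iter_dy h n) (smooth_iter_dy h' n)

theorem iter_dx_smul (a : ℂ) (Φ : Fn) (n : ℕ) : dx^[n] (a • Φ) = a • dx^[n] Φ := by
  induction n with
  | zero => rfl
  | succ n ih => simp only [Function.iterate_succ_apply', ih, dx_smul]

theorem iter_dy_smul (a : ℂ) (Φ : Fn) (n : ℕ) : dy^[n] (a • Φ) = a • dy^[n] Φ := by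
  induction n with
  | zero => rfl
  | succ n ih => simp only [Function.iterate_succ_apply', ih, dy_smul]

theorem IsSc.add {c : ℕ} {Φ Ψ : Fn} (h : IsSc c Φ) (h' : IsSc c Ψ) : IsSc c (Φ + Ψ) where
  smooth := smooth_add h.smooth h'.smooth
  quasiperiodic k x y p := by
    simp only [Pi.add_apply, h.quasiperiodic, h'.quasiperiodic]; ring
  decay P m n K hK := by
    obtain ⟨C, hC⟩ := h.decay P m n K hK
    obtain ⟨C', hC'⟩ := h'.decay P m n K hK
    refine ⟨C + C', fun v hv p => ?_⟩
    rw [iter_dy_add h.smooth h'.smooth,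
      iter_dx_add (smooth_iter_dy h.smooth n) (smooth_iter_dy h'.smooth n)]
    simp only [Pi.add_apply, mul_add]
    exact (norm_add_le _ _).trans (add_le_add (hC v hv p) (hC' v hv p))

theorem IsSc.smul {c : ℕ} {Φ : Fn} (a : ℂ) (h : IsSc c Φ) : IsSc c (a • Φ) where
  smooth := smooth_smul a h.smooth
  quasiperiodic k x y p := by
    simp only [Pi.smul_apply, h.quasiperiodic, smul_eq_mul]; ring
  decay P m n K hK := by
    obtain ⟨C, hC⟩ := h.decay P m n K hK
    refine ⟨‖a‖ * C, fun v hv p => ?_⟩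
    rw [iter_dy_smul, iter_dx_smul]
    simp only [Pi.smul_apply, smul_eq_mul]
    rw [mul_left_comm, norm_mul]
    exact mul_le_mul_of_nonneg_left (hC v hv p) (norm_nonneg a)

theorem dx_zero : dx (0 : Fn) = 0 := by simpa using dx_smul 0 (0 : Fn)

theorem dy_zero : dy (0 : Fn) = 0 := by simpa using dy_smul 0 (0 : Fn)

theorem IsSc.zero (c : ℕ) : IsSc c (0 : Fn) where
  smooth _ := contDiff_const
  quasiperiodic k x y p := by simp
  decay P m n K _ := by
    refine ⟨0, fun v _ p => ?_⟩
    rw [Function.iterate_fixed dy_zero, Function.iterate_fixed dx_zero]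
    simp

end closure

/-- The involution `Φ*(x, y, p) = conj (Φ(x, y, -p))`. -/
noncomputable def invol (Φ : Fn) : Fn := fun x y p => conj (Φ x y (-p))

/-- The real vector space `S^c_{s.a.}` of self-adjoint elements of `S^c`. -/
noncomputable def selfAdjointSc (c : ℕ) : Submodule ℝ Fn where
  carrier := {Φ | IsSc c Φ ∧ invol Φ = Φ}
  zero_mem' := ⟨IsSc.zero c, by funext x y p; simp [invol]⟩
  add_mem' := by
    rintro Φ Ψ ⟨h1, h2⟩ ⟨h3, h4⟩
    refine ⟨h1.add h3, ?_⟩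
    nth_rewrite 2 [← h2, ← h4]
    funext x y p
    simp [invol]
  smul_mem' := by
    rintro r Φ ⟨h1, h2⟩
    refine ⟨by simpa using h1.smul (r : ℂ), ?_⟩
    nth_rewrite 2 [← h2]
    funext x y p
    simp [invol]

/-! ## The representation on `L²(ℝ × 𝕋 × ℤ)` and the order -/

/-- The measure on `ℝ × 𝕋 × ℤ`: Lebesgue measure times Haar measure times counting measure. -/
noncomputable abbrev vol3 : Measure (ℝ × UnitAddCircle × ℤ) :=
  (volume : Measure ℝ).prod ((volume : Measure UnitAddCircle).prod Measure.count)

/-- The Hilbert space `L²(ℝ × 𝕋 × ℤ)`. -/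
abbrev Hilb : Type := Lp ℂ 2 vol3

/-- The function `(x, y, p) ↦ Φ(x - ħ(q - 2p)μ, y - ħ(q - 2p)ν, q)`. -/
noncomputable def coeff (ħ μ ν : ℝ) (Φ : Fn) (q : ℤ) : ℝ × UnitAddCircle × ℤ → ℂ :=
  fun v => Φ (v.1 - ħ * (q - 2 * v.2.2) * μ)
    (v.2.1 - ((ħ * (q - 2 * v.2.2) * ν : ℝ) : UnitAddCircle)) q

theorem IsSc.continuous {c : ℕ} {Φ : Fn} (h : IsSc c Φ) (q : ℤ) :
    Continuous (fun v : ℝ × UnitAddCircle => Φ v.1 v.2 q) := by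
  have hq : IsOpenQuotientMap (fun t : ℝ => (t : UnitAddCircle)) :=
    QuotientAddGroup.isOpenQuotientMap_mk
  have hq2 := (IsOpenQuotientMap.id (X := ℝ)).prodMap hq
  rw [hq2.isQuotientMap.continuous_iff]
  exact (h.smooth q).continuous

/-- The sequence `p ↦ sup_{x, y} |Φ(x, y, p)|` is dominated by a summable one. -/
theorem IsSc.exists_bound {c : ℕ} {Φ : Fn} (h : IsSc c Φ) :
    ∃ b : ℤ → ℝ, Summable b ∧ ∀ x y p, ‖Φ x y p‖ ≤ b p := by
  obtain ⟨C, hC⟩ := h.decay (Polynomial.X ^ 2 + 1) 0 0 (Set.Icc 0 1 ×ˢ Set.univ)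
    (isCompact_Icc.prod isCompact_univ)
  refine ⟨fun p => C * (1 / ((p : ℝ) ^ 2 + 1)), ?_, fun x y p => ?_⟩
  · refine Summable.mul_left _ ?_
    have hs : Summable fun p : ℤ => 1 / (p : ℝ) ^ 2 :=
      Real.summable_one_div_int_pow.mpr (by norm_num)
    refine Summable.of_norm_bounded_eventually hs ?_
    filter_upwards [(Set.finite_singleton (0 : ℤ)).compl_mem_cofinite] with p hp
    have hp' : (p : ℝ) ≠ 0 := by exact_mod_cast hp
    rw [Real.norm_of_nonneg (by positivity)]
    exact one_div_le_one_div_of_le (by positivity) (by linarith)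
  · have hx := h.quasiperiodic ⌊x⌋ (Int.fract x) y p
    rw [Int.fract_add_floor] at hx
    have hn : ‖(fourier ((c : ℤ) * ⌊x⌋ * p) y : ℂ)‖ = 1 := by
      rw [fourier_apply]; exact Circle.norm_coe _
    rw [hx, norm_mul, hn, one_mul]
    have h1 := hC (Int.fract x, y)
      ⟨⟨Int.fract_nonneg x, (Int.fract_lt_one x).le⟩, Set.mem_univ _⟩ p
    have h2 : ‖(Polynomial.X ^ 2 + 1 : Polynomial ℂ).eval (p : ℂ)‖ = (p : ℝ) ^ 2 + 1 := by
      have : (Polynomial.X ^ 2 + 1 : Polynomial ℂ).eval (p : ℂ) = (((p : ℝ) ^ 2 + 1 : ℝ) : ℂ) := by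
        simp
      rw [this, Complex.norm_real, Real.norm_of_nonneg (by positivity)]
    rw [norm_mul, h2] at h1
    simp only [Function.iterate_zero, id_eq] at h1
    change _ ≤ C * (1 / ((p : ℝ) ^ 2 + 1))
    rw [mul_one_div, le_div_iff₀ (by positivity), mul_comm]
    exact h1

theorem IsSc.memLp_coeff {c : ℕ} {Φ : Fn} (h : IsSc c Φ) (ħ μ ν : ℝ) (q : ℤ) :
    MemLp (coeff ħ μ ν Φ q) ∞ vol3 := by
  obtain ⟨b, _, hb⟩ := h.exists_bound
  have hc : Continuous (coeff ħ μ ν Φ q) := by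
    refine (h.continuous q).comp (Continuous.prodMk ?_ ?_)
    · have : Continuous fun v : ℝ × UnitAddCircle × ℤ => (v.2.2 : ℝ) :=
        continuous_of_discreteTopology.comp (continuous_snd.comp continuous_snd)
      fun_prop
    · have h1 : Continuous fun v : ℝ × UnitAddCircle × ℤ =>
          ((ħ * (q - 2 * v.2.2) * ν : ℝ) : UnitAddCircle) :=
        (continuous_of_discreteTopology
          (f := fun p : ℤ => ((ħ * (q - 2 * p) * ν : ℝ) : UnitAddCircle))).comp
          (continuous_snd.comp continuous_snd)
      exact (continuous_fst.comp continuous_snd).sub h1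
  exact memLp_top_of_bound hc.measurable.aestronglyMeasurable (b q)
    (Filter.Eventually.of_forall fun v => hb _ _ _)

theorem shift_measurePreserving (q : ℤ) :
    MeasurePreserving (fun v : ℝ × UnitAddCircle × ℤ => (v.1, v.2.1, v.2.2 - q)) vol3 vol3 := by
  have h1 : MeasurePreserving (fun p : ℤ => p - q) Measure.count Measure.count :=
    measurePreserving_sub_right _ q
  exact (MeasurePreserving.id _).prod ((MeasurePreserving.id _).prod h1)

/-- The translation `ξ(x, y, p) ↦ ξ(x, y, p - q)` on `L²`. -/
noncomputable def shift (q : ℤ) : Hilb →L[ℂ] Hilb :=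
  (Lp.compMeasurePreservingₗᵢ ℂ _ (shift_measurePreserving q)).toContinuousLinearMap

/-- The operator `ξ ↦ ((x, y, p) ↦ Φ(x - ħ(q - 2p)μ, y - ħ(q - 2p)ν, q) ξ(x, y, p - q))`. -/
noncomputable def repTerm {c : ℕ} {Φ : Fn} (h : IsSc c Φ) (ħ μ ν : ℝ) (q : ℤ) : Hilb →L[ℂ] Hilb :=
  ((ContinuousLinearMap.mul ℂ ℂ).holderL vol3 ∞ 2 2 ((h.memLp_coeff ħ μ ν q).toLp _)).comp
    (shift q)

/-- The operator `π(Φ)` on `L²(ℝ × 𝕋 × ℤ)`, for `Φ ∈ S^c`, as an operator-norm convergent sum;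
see `rep_apply` for the pointwise formula. -/
noncomputable def rep {c : ℕ} {Φ : Fn} (h : IsSc c Φ) (ħ μ ν : ℝ) : Hilb →L[ℂ] Hilb :=
  ∑' q : ℤ, repTerm h ħ μ ν q

theorem repTerm_apply {c : ℕ} {Φ : Fn} (h : IsSc c Φ) (ħ μ ν : ℝ) (q : ℤ) (ξ : Hilb) :
    repTerm h ħ μ ν q ξ =ᵐ[vol3]
      fun v => coeff ħ μ ν Φ q v * ξ (v.1, v.2.1, v.2.2 - q) := by
  have h1 := (ContinuousLinearMap.mul ℂ ℂ).coeFn_holder (r := 2)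
    ((h.memLp_coeff ħ μ ν q).toLp _) (shift q ξ)
  have h2 := (h.memLp_coeff ħ μ ν q).coeFn_toLp
  have h3 := Lp.coeFn_compMeasurePreserving ξ (shift_measurePreserving q)
  filter_upwards [h1, h2, h3] with v e1 e2 e3
  refine e1.trans ?_
  rw [e2]
  exact congrArg _ e3

theorem norm_repTerm_le {c : ℕ} {Φ : Fn} (h : IsSc c Φ) (ħ μ ν : ℝ) (q : ℤ) {B : ℝ}
    (hB : ∀ x y, ‖Φ x y q‖ ≤ B) : ‖repTerm h ħ μ ν q‖ ≤ B := by
  have hb0 : 0 ≤ B := (norm_nonneg _).trans (hB 0 0)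
  refine ContinuousLinearMap.opNorm_le_bound _ hb0 fun ξ => ?_
  have hs : ‖shift q ξ‖ = ‖ξ‖ := Lp.norm_compMeasurePreserving ξ (shift_measurePreserving q)
  rw [← hs]
  refine Lp.norm_le_mul_norm_of_ae_le_mul ?_
  have h3 : shift q ξ =ᵐ[vol3] _ := Lp.coeFn_compMeasurePreserving ξ (shift_measurePreserving q)
  filter_upwards [repTerm_apply h ħ μ ν q ξ, h3] with v e1 e3
  rw [e1, e3, norm_mul]
  exact mul_le_mul_of_nonneg_right (hB _ _) (norm_nonneg _)

theorem repTerm_summable {c : ℕ} {Φ : Fn} (h : IsSc c Φ) (ħ μ ν : ℝ) :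
    Summable fun q : ℤ => ‖repTerm h ħ μ ν q‖ := by
  obtain ⟨b, hs, hb⟩ := h.exists_bound
  exact Summable.of_nonneg_of_le (fun _ => norm_nonneg _)
    (fun q => norm_repTerm_le h ħ μ ν q fun x y => hb x y q) hs

/-- `(π(Φ)ξ)(x, y, p) = ∑_q Φ(x - ħ(q - 2p)μ, y - ħ(q - 2p)ν, q) ξ(x, y, p - q)`. -/
theorem rep_apply {c : ℕ} {Φ : Fn} (h : IsSc c Φ) (ħ μ ν : ℝ) (ξ : Hilb) :
    ∀ᵐ v ∂vol3, HasSum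
      (fun q : ℤ => Φ (v.1 - ħ * (q - 2 * v.2.2) * μ)
        (v.2.1 - ((ħ * (q - 2 * v.2.2) * ν : ℝ) : UnitAddCircle)) q * ξ (v.1, v.2.1, v.2.2 - q))
      (rep h ħ μ ν ξ v) := by
  have hs := repTerm_summable h ħ μ ν
  have hs2 : Summable fun q : ℤ => ‖repTerm h ħ μ ν q ξ‖ :=
    Summable.of_nonneg_of_le (fun _ => norm_nonneg _)
      (fun q => (repTerm h ħ μ ν q).le_opNorm ξ) (hs.mul_right ‖ξ‖)
  have hfin : ∑' q : ℤ, ‖repTerm h ħ μ ν q ξ‖ₑ ≠ ⊤ :=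
    tsum_enorm_ne_top_iff_summable_norm.2 hs2
  have e : rep h ħ μ ν ξ = ∑' q : ℤ, repTerm h ħ μ ν q ξ :=
    ((ContinuousLinearMap.apply ℂ Hilb ξ).map_tsum hs.of_norm)
  rw [e]
  filter_upwards [Lp.hasSum_coeFn_tsum hfin, ae_all_iff.2 fun q => repTerm_apply h ħ μ ν q ξ]
    with v h1 h2
  convert! h1 using 2 with q
  exact (h2 q).symm

/-- The real vector space `A = S^c_{s.a.}`, regarded for the parameters `ħ, μ, ν` as a space of
self-adjoint operators on `L²(ℝ × 𝕋 × ℤ)` through `π`. -/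
def SA (c : ℕ) (_ħ _μ _ν : ℝ) : Type := selfAdjointSc c

noncomputable instance (c : ℕ) (ħ μ ν : ℝ) : AddCommGroup (SA c ħ μ ν) :=
  inferInstanceAs (AddCommGroup (selfAdjointSc c))

noncomputable instance (c : ℕ) (ħ μ ν : ℝ) : Module ℝ (SA c ħ μ ν) :=
  inferInstanceAs (Module ℝ (selfAdjointSc c))

/-- The operator `π(φ)`. -/
noncomputable def SA.op {c : ℕ} {ħ μ ν : ℝ} (φ : SA c ħ μ ν) : Hilb →L[ℂ] Hilb :=
  rep φ.2.1 ħ μ ν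

/-- The underlying function of `φ`. -/
def SA.fn {c : ℕ} {ħ μ ν : ℝ} (φ : SA c ħ μ ν) : Fn := φ.1

/-- The order inherited from the C*-algebra: `φ ≤ ψ` iff `π(ψ) - π(φ)` is a positive operator. -/
noncomputable instance (c : ℕ) (ħ μ ν : ℝ) : Preorder (SA c ħ μ ν) :=
  Preorder.lift SA.op

/-- The identity `I(x, y, p) = δ_{p,0}`. -/
noncomputable def oneFn : Fn := fun _ _ p => if p = 0 then 1 else 0

theorem isSc_oneFn (c : ℕ) : IsSc c oneFn where
  smooth _ := contDiff_const
  quasiperiodic k x y p := by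
    by_cases hp : p = 0 <;> simp [oneFn, hp]
  decay P m n K _ := by
    have hx : dx oneFn = 0 := by funext x y p; simp [dx, oneFn]
    have hy : dy oneFn = 0 := by funext x y p; simp [dy, oneFn]
    have hx0 (n : ℕ) : dx^[n] oneFn = oneFn ∨ dx^[n] oneFn = 0 := by
      cases n with
      | zero => exact Or.inl rfl
      | succ n => exact Or.inr (by
          rw [Function.iterate_succ_apply, hx, Function.iterate_fixed dx_zero])
    have hy0 : dy^[n] oneFn = oneFn ∨ dy^[n] oneFn = 0 := by
      cases n with
      | zero => exact Or.inl rfl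
      | succ n => exact Or.inr (by
          rw [Function.iterate_succ_apply, hy, Function.iterate_fixed dy_zero])
    have h0 : dx^[m] (dy^[n] oneFn) = oneFn ∨ dx^[m] (dy^[n] oneFn) = 0 := by
      rcases hy0 with e | e
      · rw [e]; exact hx0 m
      · rw [e, Function.iterate_fixed dx_zero]; exact Or.inr rfl
    refine ⟨‖P.eval 0‖, fun v _ p => ?_⟩
    rcases h0 with e | e
    · rw [e]
      by_cases hp : p = 0 <;> simp [oneFn, hp]
    · rw [e]; simp

/-- The identity as an element of `A`. -/
noncomputable def SA.one (c : ℕ) (ħ μ ν : ℝ) : SA c ħ μ ν :=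
  ⟨oneFn, isSc_oneFn c, by
    funext x y p
    by_cases hp : p = 0 <;> simp [invol, oneFn, hp]⟩

theorem SA.op_one (c : ℕ) (ħ μ ν : ℝ) : (SA.one c ħ μ ν).op = 1 := by
  ext1 ξ
  apply Lp.ext
  filter_upwards [rep_apply (SA.one c ħ μ ν).2.1 ħ μ ν ξ] with v hv
  have h0 := hasSum_ite_eq (0 : ℤ) (ξ v)
  refine hv.unique ?_
  convert! h0 using 2 with q
  by_cases hq : q = 0
  · subst hq; simp [SA.one, oneFn]
  · simp [SA.one, oneFn, hq]

/-! ## The derivations and the seminorm `L` -/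

/-- `δ₁ = -∂/∂x`. -/
noncomputable def δ₁ (Φ : Fn) : Fn := fun x y p => -dx Φ x y p

/-- `δ₂ = 2πi c p x - ∂/∂y`. -/
noncomputable def δ₂ (c : ℕ) (Φ : Fn) : Fn :=
  fun x y p => 2 * Real.pi * Complex.I * c * p * x * Φ x y p - dy Φ x y p

/-- `δ₃ = 2πi p`. -/
noncomputable def δ₃ (Φ : Fn) : Fn := fun x y p => 2 * Real.pi * Complex.I * p * Φ x y p

/-- `‖Φ‖_{∞,∞,1} = ∑_p sup_{x,y} |Φ(x, y, p)|`, with values in `[0, ∞]`. -/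
noncomputable def norm₁ (Φ : Fn) : ℝ≥0∞ := ∑' p : ℤ, ⨆ (x : ℝ) (y : UnitAddCircle), ‖Φ x y p‖ₑ

/-- `L(φ) = max_i ‖δ_i(φ)‖_{∞,∞,1}`, with values in `[0, ∞]`. -/
noncomputable def lipE {c : ℕ} {ħ μ ν : ℝ} (φ : SA c ħ μ ν) : ℝ≥0∞ :=
  norm₁ (δ₁ φ.fn) ⊔ norm₁ (δ₂ c φ.fn) ⊔ norm₁ (δ₃ φ.fn)

/-- `L(φ)` as a real number. -/
noncomputable def lip {c : ℕ} {ħ μ ν : ℝ} (φ : SA c ħ μ ν) : ℝ := (lipE φ).toReal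

end QHM

/-! ## Total boundedness and Lip norms -/

/-! The C*-norm is dominated by `‖·‖_{∞,∞,1}`, so it suffices to see that `L` controls the latter up
to scalars and finitely many parameters. Since `δ₃` multiplies the mode `p` by `2πip`, the modes
with `|p| ≥ N` contribute at most `L/N` (`norm₁_le_sum_add`). In each remaining mode, `δ₁` and `δ₂`
give Lipschitz bounds in `x` and `y`: the zeroth-order part of `δ₂` is `c x δ₃`, already controlled
by `L`. Quasiperiodicity reduces everything to the unit square, so the values on a finite grid in
finitely many modes determine an element of the `L`-ball up to a small error, and norm-bounded parts
of that ball are totally bounded (`totallyBounded_lip_ball`). Mode `0` oscillates by at most `2L`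
about the real number `φ(0,0,0)`, so the `L`-ball is bounded modulo `ℝI` (`norm_op_sub_le`). These
two facts give a Lip norm (`isLipNorm_of_totallyBounded`), once states are bounded by the operator
norm (`SA.abs_state_le`). The order unit axioms come from those of the Loewner order, because `π` is
faithful and maps `A` to symmetric operators. -/

theorem totallyBounded_image_of_approx {α E : Type*} [PseudoMetricSpace E] {S : Set α} {T : α → E}
    (h : ∀ ε > 0, ∃ (ι : Type) (_ : Fintype ι) (F : α → ι → ℂ) (δ : ℝ), 0 < δ ∧
      Bornology.IsBounded (F '' S) ∧
      ∀ a ∈ S, ∀ b ∈ S, dist (F a) (F b) < δ → dist (T a) (T b) < ε) :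
    TotallyBounded (T '' S) := by
  rw [Metric.totallyBounded_iff]
  intro ε hε
  obtain ⟨ι, _, F, δ, hδ, hF, hd⟩ := h ε hε
  -- Bounded sets in the finite-dimensional space `ι → ℂ` are relatively compact; a finite net there
  -- is pulled back to points of `S`.
  have hF' : TotallyBounded (F '' S) :=
    hF.isCompact_closure.totallyBounded.subset subset_closure
  obtain ⟨t, htS, htf, ht⟩ := Metric.finite_approx_of_totallyBounded hF' δ hδ
  obtain ⟨u, huS, huf, rfl⟩ := Set.exists_subset_image_finite_and.1 ⟨t, htS, htf, rfl⟩
  refine ⟨T '' u, huf.image T, ?_⟩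
  rintro _ ⟨a, ha, rfl⟩
  have := ht (Set.mem_image_of_mem F ha)
  simp only [Set.mem_iUnion, Metric.mem_ball, Set.mem_image, exists_prop] at this ⊢
  obtain ⟨_, ⟨b, hb, rfl⟩, hab⟩ := this
  exact ⟨T b, ⟨b, hb, rfl⟩, hd a ha b (huS hb) hab⟩

section LipNorm

variable {A : Type*} [AddCommGroup A] [Module ℝ A] [Preorder A]

/-- The set of differences whose supremum is `ρ_L(f, g)`. -/
def lipDiffs {e : A} (L : A → ℝ) (f g : StateSpace e) : Set ℝ :=
  {s : ℝ | ∃ a : A, L a ≤ 1 ∧ s = |f.1 a - g.1 a|}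

/-- A criterion for Lip norms: the unit ball of `L` is bounded modulo scalars, and its
bounded parts are totally bounded, for a norm that dominates all states. -/
theorem isLipNorm_of_totallyBounded {E : Type*} [NormedAddCommGroup E] [NormedSpace ℝ E] {e : A}
    {L : A → ℝ} (T : A →ₗ[ℝ] E) (nonneg : ∀ a, 0 ≤ L a)
    (add_le : ∀ a b, L (a + b) ≤ L a + L b)
    (smul : ∀ (r : ℝ) (a : A), L (r • a) = |r| * L a)
    (eq_zero_iff : ∀ a, L a = 0 ↔ ∃ r : ℝ, a = r • e)
    (state_le : ∀ f : A →ₗ[ℝ] ℝ, IsState e f → ∀ a, |f a| ≤ ‖T a‖)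
    {R : ℝ} (radius : ∀ a, L a ≤ 1 → ∃ r : ℝ, ‖T (a - r • e)‖ ≤ R)
    (tb : TotallyBounded (T '' {a | L a ≤ 1 ∧ ‖T a‖ ≤ R})) : IsLipNorm e L := by
  -- States agree on multiples of `e` and `L` vanishes on them, so `ρ_L` only sees the bounded part
  -- of the `L`-ball.
  have hshift : ∀ a, L a ≤ 1 → ∃ b, L b ≤ 1 ∧ ‖T b‖ ≤ R ∧
      ∀ f g : StateSpace e, f.1 a - g.1 a = f.1 b - g.1 b := by
    intro a ha
    obtain ⟨r, hr⟩ := radius a ha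
    refine ⟨a - r • e, ?_, hr, fun f g => ?_⟩
    · have h1 := add_le a ((-r) • e)
      rw [(eq_zero_iff ((-r) • e)).2 ⟨-r, rfl⟩, neg_smul, ← sub_eq_add_neg] at h1
      linarith
    · rw [map_sub, map_sub, map_smul, map_smul, f.2.1, g.2.1]; ring
  have hbdd : ∀ f g : StateSpace e, BddAbove (lipDiffs L f g) := by
    refine fun f g => ⟨2 * R, ?_⟩
    rintro _ ⟨a, ha, rfl⟩
    obtain ⟨b, _, hb, hfg⟩ := hshift a ha
    rw [hfg]
    have h1 := abs_sub (f.1 b) (g.1 b)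
    have h2 := state_le f.1 f.2 b
    have h3 := state_le g.1 g.2 b
    linarith
  have h0 : L 0 = 0 := by simpa using smul 0 0
  have hne : ∀ f g : StateSpace e, (lipDiffs L f g).Nonempty :=
    fun f g => ⟨_, 0, by rw [h0]; exact zero_le_one, rfl⟩
  have hlub : ∀ f g : StateSpace e, IsLUB (lipDiffs L f g) (sSup (lipDiffs L f g)) :=
    fun f g => isLUB_csSup (hne f g) (hbdd f g)
  have heval : ∀ (a : A) (f g : StateSpace e),
      |f.1 a - g.1 a| ≤ (L a + 1) * sSup (lipDiffs L f g) := by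
    intro a f g
    -- Dividing by `L a + 1` instead of `L a` covers the case `L a = 0`.
    have hpos : 0 < L a + 1 := by linarith [nonneg a]
    have h1 := (hlub f g).1 ⟨(L a + 1)⁻¹ • a, by
      rw [smul, abs_of_pos (inv_pos.2 hpos), inv_mul_le_iff₀ hpos]; linarith, rfl⟩
    rw [map_smul, map_smul, ← smul_sub, smul_eq_mul, abs_mul, abs_of_pos (inv_pos.2 hpos),
      inv_mul_le_iff₀ hpos] at h1
    exact h1
  have hnn : ∀ f g : StateSpace e, 0 ≤ sSup (lipDiffs L f g) := fun f g =>
    Real.sSup_nonneg (by rintro _ ⟨a, _, rfl⟩; exact abs_nonneg _)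
  let d : MetricSpace (StateSpace e) :=
    { dist := fun f g => sSup (lipDiffs L f g)
      dist_self := fun f => by
        refine le_antisymm ((hlub f f).2 ?_) (hnn f f)
        rintro _ ⟨a, _, rfl⟩
        simp
      dist_comm := fun f g => by simp only [lipDiffs, abs_sub_comm]
      dist_triangle := fun f g h => by
        refine (hlub f h).2 ?_
        rintro _ ⟨a, ha, rfl⟩
        exact (abs_sub_le _ (g.1 a) _).trans
          (add_le_add ((hlub f g).1 ⟨a, ha, rfl⟩) ((hlub g h).1 ⟨a, ha, rfl⟩))
      eq_of_dist_eq_zero := fun {f g} hfg => by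
        refine Subtype.ext (LinearMap.ext fun a => ?_)
        have h1 := heval a f g
        change sSup (lipDiffs L f g) = 0 at hfg
        rw [hfg, mul_zero] at h1
        exact sub_eq_zero.1 (abs_nonpos_iff.1 h1) }
  refine ⟨nonneg, add_le, smul, eq_zero_iff, d, hlub, le_antisymm ?_ ?_⟩
  · rw [← continuous_iff_le_induced]
    refine continuous_pi fun a => ?_
    have hL : LipschitzWith (L a + 1).toNNReal fun f : StateSpace e => f.1 a := by
      refine LipschitzWith.of_dist_le_mul fun f g => ?_
      rw [Real.coe_toNNReal _ (by linarith [nonneg a]), Real.dist_eq]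
      exact heval a f g
    exact hL.continuous
  -- Closeness on a finite `ε/3`-net of the bounded part is a `w*`-open condition; it spreads to the
  -- whole part because every state is 1-Lipschitz for `‖T ·‖`.
  · refine le_of_nhds_le_nhds fun f => ?_
    refine (Metric.nhds_basis_closedBall (x := f)).ge_iff.2 fun ε hε => ?_
    obtain ⟨t, htS, htf, ht⟩ := Metric.finite_approx_of_totallyBounded tb (ε / 3) (by linarith)
    obtain ⟨u, huS, huf, rfl⟩ := Set.exists_subset_image_finite_and.1 ⟨t, htS, htf, rfl⟩
    have hopen : ∀ᶠ g in @nhds _ (weakStarTopology e) f, ∀ b ∈ u, |g.1 b - f.1 b| < ε / 3 := by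
      rw [Filter.eventually_all_finite huf]
      intro b _
      let := weakStarTopology e
      have hc : Continuous fun g : StateSpace e => g.1 b :=
        (continuous_apply b).comp continuous_induced_dom
      have := hc.continuousAt.eventually (Metric.ball_mem_nhds (f.1 b) (by linarith : 0 < ε / 3))
      simpa [Real.dist_eq] using this
    refine Filter.mem_of_superset hopen fun g hg => ?_
    refine (hlub g f).2 ?_
    rintro _ ⟨a, ha, rfl⟩
    obtain ⟨a', ha1, ha2, hfg⟩ := hshift a ha
    rw [hfg]
    have := ht (Set.mem_image_of_mem T (show a' ∈ {a | L a ≤ 1 ∧ ‖T a‖ ≤ R} from ⟨ha1, ha2⟩))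
    simp only [Set.mem_iUnion, Metric.mem_ball, Set.mem_image, exists_prop] at this
    obtain ⟨_, ⟨b, hb, rfl⟩, hab⟩ := this
    rw [dist_eq_norm, ← map_sub] at hab
    have h1 := (state_le g.1 g.2 (a' - b)).trans_lt hab
    have h2 := (state_le f.1 f.2 (a' - b)).trans_lt hab
    have h3 := hg b hb
    rw [map_sub, abs_lt] at h1 h2
    rw [abs_lt] at h3
    rw [abs_le]
    constructor <;> linarith

end LipNorm

/-! ### Symmetric operators and the Loewner order -/

section Operators

variable {E : Type*} [NormedAddCommGroup E] [InnerProductSpace ℂ E]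

theorem isSymmetric_tsum_of_neg {T : ℤ → E →L[ℂ] E} (hT : Summable T)
    (h : ∀ q ξ η, inner ℂ (T q ξ) η = inner ℂ ξ (T (-q) η)) :
    ((∑' q, T q : E →L[ℂ] E) : E →ₗ[ℂ] E).IsSymmetric := by
  intro ξ η
  have h1 : ∀ ζ : E, HasSum (fun q => T q ζ) ((∑' q, T q) ζ) := fun ζ =>
    (ContinuousLinearMap.apply ℂ E ζ).hasSum hT.hasSum
  have h2 : HasSum (fun q => inner ℂ ξ (T q η)) (inner ℂ ξ ((∑' q, T q) η)) :=
    (innerSL ℂ ξ).hasSum (h1 η)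
  have h3 : HasSum (fun q => inner ℂ (T q ξ) η) (inner ℂ ((∑' q, T q) ξ) η) := by
    have := ((innerSL ℂ η).hasSum (h1 ξ)).star
    simpa using this
  refine h3.unique ?_
  rw [← (Equiv.neg ℤ).hasSum_iff] at h2
  exact h2.congr_fun fun q => h q ξ η

/-- Positivity of `r - T` includes its symmetry, which `hT` supplies; only the quadratic form is
left to compare. -/
theorem le_smul_one_iff_inner_le {T : E →L[ℂ] E} (hT : (T : E →ₗ[ℂ] E).IsSymmetric) (r : ℝ) :
    T ≤ (r : ℂ) • 1 ↔ ∀ ξ : E, (inner ℂ (T ξ) ξ).re ≤ r * ‖ξ‖ ^ 2 := by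
  have e : ∀ ξ : E, (inner ℂ (((r : ℂ) • 1 - T : E →L[ℂ] E) ξ) ξ).re =
      r * ‖ξ‖ ^ 2 - (inner ℂ (T ξ) ξ).re := by
    intro ξ
    rw [sub_apply, inner_sub_left, Complex.sub_re, smul_apply, one_apply_eq_self,
      inner_smul_left, inner_self_eq_norm_sq_to_K]
    simp [← Complex.ofReal_pow]
  rw [ContinuousLinearMap.le_def]
  constructor
  · intro h ξ
    have h1 := h.re_inner_nonneg_left ξ
    have h2 := e ξ
    change 0 ≤ (inner ℂ _ ξ).re at h1
    linarith
  · intro h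
    refine ⟨fun ξ η => ?_, fun ξ => ?_⟩
    · have := hT ξ η
      change inner ℂ (T ξ) η = inner ℂ ξ (T η) at this
      change inner ℂ (((r : ℂ) • 1 - T : E →L[ℂ] E) ξ) η =
        inner ℂ ξ (((r : ℂ) • 1 - T : E →L[ℂ] E) η)
      simp only [sub_apply, smul_apply, one_apply_eq_self, inner_sub_left, inner_sub_right,
        inner_smul_left, inner_smul_right, this, Complex.conj_ofReal]
    · change 0 ≤ (inner ℂ (((r : ℂ) • 1 - T : E →L[ℂ] E) ξ) ξ).re
      rw [e]
      linarith [h ξ]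

theorem smul_le_smul_of_loewner_le {S T : E →L[ℂ] E} (h : S ≤ T) {r : ℝ} (hr : 0 ≤ r) :
    (r : ℂ) • S ≤ (r : ℂ) • T := by
  rw [ContinuousLinearMap.le_def, ← smul_sub]
  exact ((ContinuousLinearMap.le_def _ _).1 h).smul_of_nonneg (by simpa using hr)

theorem add_le_add_of_loewner_le {S T : E →L[ℂ] E} (h : S ≤ T) (U : E →L[ℂ] E) :
    S + U ≤ T + U := by
  rwa [ContinuousLinearMap.le_def, add_sub_add_right_eq_sub]

theorem neg_le_of_loewner_neg_le {S T : E →L[ℂ] E} (h : -S ≤ T) : -T ≤ S := by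
  rwa [ContinuousLinearMap.le_def, sub_neg_eq_add, add_comm, ← sub_neg_eq_add]

/-- If `r < 0`, then `0 ≤ -r·1 ≤ r·1 ≤ 0`, so `r·1 = 0`. This bounds below the set defining the
order unit norm. -/
theorem eq_zero_or_nonneg_of_neg_smul_one_le {r : ℝ}
    (h : -((r : ℂ) • (1 : E →L[ℂ] E)) ≤ (r : ℂ) • 1) :
    (1 : E →L[ℂ] E) = 0 ∨ 0 ≤ r := by
  refine or_iff_not_imp_right.2 fun hr => ?_
  rw [not_le] at hr
  have h4 := smul_le_smul_of_loewner_le (ContinuousLinearMap.nonneg_iff_isPositive _ |>.2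
    (ContinuousLinearMap.isPositive_one (E := E) (𝕜 := ℂ))) (neg_nonneg.2 hr.le)
  rw [Complex.ofReal_neg, neg_smul, neg_smul, smul_zero, neg_zero] at h4
  have h6 := neg_le_of_loewner_neg_le (neg_zero.trans_le h4)
  rw [neg_neg] at h6
  have h5 : (r : ℂ) • (1 : E →L[ℂ] E) = 0 := le_antisymm h6 (h4.trans h)
  rcases smul_eq_zero.1 h5 with h | h
  · exact absurd (Complex.ofReal_eq_zero.1 h) hr.ne
  · exact h

end Operators

namespace QHM

/-! ## Linearity, self-adjointness and faithfulness of `π` -/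

/-- Sums are unique, so the pointwise formula characterizes `π(Φ)` and linearity can be checked on
coefficients. -/
theorem rep_eq_of_hasSum {c : ℕ} {Φ : Fn} (h : IsSc c Φ) {ħ μ ν : ℝ} {T : Hilb →L[ℂ] Hilb}
    (H : ∀ ξ : Hilb, ∀ᵐ v ∂vol3,
      HasSum (fun q : ℤ => coeff ħ μ ν Φ q v * ξ (v.1, v.2.1, v.2.2 - q)) (T ξ v)) :
    rep h ħ μ ν = T := by
  ext1 ξ
  apply Lp.ext
  filter_upwards [rep_apply h ħ μ ν ξ, H ξ] with v h1 h2
  exact h1.unique h2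

variable {c : ℕ} {ħ μ ν : ℝ}

theorem SA.op_add (φ ψ : SA c ħ μ ν) : (φ + ψ).op = φ.op + ψ.op := by
  refine rep_eq_of_hasSum _ fun ξ => ?_
  filter_upwards [rep_apply φ.2.1 ħ μ ν ξ, rep_apply ψ.2.1 ħ μ ν ξ,
    Lp.coeFn_add (φ.op ξ) (ψ.op ξ)] with v h1 h2 h3
  rw [add_apply, h3]
  refine (h1.add h2).congr_fun ?_
  intro q
  exact add_mul _ _ _

theorem SA.op_complex_smul (r : ℝ) (φ : SA c ħ μ ν) : (r • φ).op = (r : ℂ) • φ.op := by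
  refine rep_eq_of_hasSum _ fun ξ => ?_
  filter_upwards [rep_apply φ.2.1 ħ μ ν ξ, Lp.coeFn_smul (r : ℂ) (φ.op ξ)] with v h1 h3
  rw [smul_apply, h3]
  refine (h1.const_smul (r : ℂ)).congr_fun fun q => ?_
  have e : coeff ħ μ ν (r • φ).1 q v = (r : ℂ) * coeff ħ μ ν φ.1 q v := Complex.real_smul
  rw [e, mul_assoc]
  rfl

theorem SA.op_smul (r : ℝ) (φ : SA c ħ μ ν) : (r • φ).op = r • φ.op := by
  refine rep_eq_of_hasSum _ fun ξ => ?_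
  filter_upwards [rep_apply φ.2.1 ħ μ ν ξ, Lp.coeFn_smul r (φ.op ξ)] with v h1 h3
  rw [smul_apply, h3]
  refine (h1.const_smul r).congr_fun fun q => ?_
  exact smul_mul_assoc r (coeff ħ μ ν φ.1 q v) _

/-- `π` as a real linear map. -/
noncomputable def SA.opₗ (c : ℕ) (ħ μ ν : ℝ) : SA c ħ μ ν →ₗ[ℝ] (Hilb →L[ℂ] Hilb) where
  toFun := SA.op
  map_add' := SA.op_add
  map_smul' := SA.op_smul

theorem SA.op_sub (φ ψ : SA c ħ μ ν) : (φ - ψ).op = φ.op - ψ.op :=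
  map_sub (SA.opₗ c ħ μ ν) φ ψ

theorem SA.op_neg (φ : SA c ħ μ ν) : (-φ).op = -φ.op :=
  map_neg (SA.opₗ c ħ μ ν) φ

theorem shift_measurableEmbedding (q : ℤ) : MeasurableEmbedding
    (fun v : ℝ × UnitAddCircle × ℤ => (v.1, v.2.1, v.2.2 - q)) :=
  ((MeasurableEquiv.refl ℝ).prodCongr ((MeasurableEquiv.refl UnitAddCircle).prodCongr
    (MeasurableEquiv.subRight q))).measurableEmbedding

/-- Translating `p` to `p - q` sends the shift parameter of mode `-q` to `-q - 2(p - q) = q - 2p`,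
that of mode `q`; then `Φ* = Φ` yields the conjugate coefficient. -/
theorem inner_repTerm {Φ : Fn} (h : IsSc c Φ) (hΦ : invol Φ = Φ) (q : ℤ) (ξ η : Hilb) :
    inner ℂ (repTerm h ħ μ ν q ξ) η = inner ℂ ξ (repTerm h ħ μ ν (-q) η) := by
  rw [L2.inner_def, L2.inner_def, ← (shift_measurePreserving q).integral_comp
    (shift_measurableEmbedding q) (fun v => inner ℂ (ξ v) (repTerm h ħ μ ν (-q) η v))]
  have h2 := (shift_measurePreserving q).quasiMeasurePreserving.ae
    (repTerm_apply h ħ μ ν (-q) η)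
  refine integral_congr_ae ?_
  filter_upwards [repTerm_apply h ħ μ ν q ξ, h2] with v h1 h2
  rw [h1, h2]
  have e : coeff ħ μ ν Φ (-q) (v.1, v.2.1, v.2.2 - q) = conj (coeff ħ μ ν Φ q v) := by
    simp only [coeff]
    nth_rewrite 1 [← hΦ]
    simp only [invol, neg_neg]
    have : ((-q : ℤ) : ℝ) - 2 * ((v.2.2 - q : ℤ) : ℝ) = q - 2 * v.2.2 := by push_cast; ring
    rw [this]
  rw [e]
  simp only [RCLike.inner_apply, map_mul, sub_neg_eq_add, sub_add_cancel]
  ring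

theorem SA.op_isSymmetric (φ : SA c ħ μ ν) : (φ.op : Hilb →ₗ[ℂ] Hilb).IsSymmetric :=
  isSymmetric_tsum_of_neg (repTerm_summable φ.2.1 ħ μ ν).of_norm (inner_repTerm φ.2.1 φ.2.2)

/-- Allows passing from a.e. equality to equality of continuous functions on open sets. -/
instance : (Measure.count : Measure ℤ).IsOpenPosMeasure :=
  ⟨fun _ _ hne => Measure.count_ne_zero hne⟩

theorem IsSc.continuous_coeff {Φ : Fn} (h : IsSc c Φ) (q : ℤ) :
    Continuous fun v : ℝ × UnitAddCircle × ℤ => coeff ħ μ ν Φ q v := by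
  refine (h.continuous q).comp (Continuous.prodMk ?_ ?_)
  · have : Continuous fun v : ℝ × UnitAddCircle × ℤ => (v.2.2 : ℝ) :=
      continuous_of_discreteTopology.comp (continuous_snd.comp continuous_snd)
    fun_prop
  · exact (continuous_fst.comp continuous_snd).sub
      ((continuous_of_discreteTopology
        (f := fun p : ℤ => ((ħ * (q - 2 * p) * ν : ℝ) : UnitAddCircle))).comp
        (continuous_snd.comp continuous_snd))

/-- `π` is faithful. -/
theorem eq_zero_of_rep_eq_zero {Φ : Fn} (h : IsSc c Φ) (h0 : rep h ħ μ ν = 0) : Φ = 0 := by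
  funext x y p
  -- The coefficient of mode `p` takes the value `Φ(x,y,p)` at `(x - ħpμ, y - ħpν, p)`; `N` makes
  -- this an interior point of the test region.
  set N : ℝ := |x - ħ * p * μ| + 1
  let s : Set (ℝ × UnitAddCircle × ℤ) := Set.Icc (-N) N ×ˢ Set.univ ×ˢ {0}
  have hs : MeasurableSet s :=
    measurableSet_Icc.prod (MeasurableSet.univ.prod (measurableSet_singleton 0))
  have hsf : vol3 s ≠ ⊤ := by
    simp only [s, Measure.prod_prod, Measure.count_singleton, Real.volume_Icc, mul_one]
    exact ENNReal.mul_ne_top ENNReal.ofReal_ne_top (measure_ne_top _ _)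
  -- The test vector lives on the slice `0`, so on the slice `p` only the term `q = p` survives.
  let ξ : Hilb := indicatorConstLp 2 hs hsf 1
  have hξ : ∀ᵐ v ∂vol3, ∀ q : ℤ, ξ (v.1, v.2.1, v.2.2 - q) =
      s.indicator (fun _ => (1 : ℂ)) (v.1, v.2.1, v.2.2 - q) :=
    ae_all_iff.2 fun q => (shift_measurePreserving q).quasiMeasurePreserving.ae
      (indicatorConstLp_coeFn (p := 2) (hs := hs) (hμs := hsf) (c := (1 : ℂ)))
  let U : Set (ℝ × UnitAddCircle × ℤ) := Set.Ioo (-N) N ×ˢ Set.univ ×ˢ {p}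
  have hU : IsOpen U := isOpen_Ioo.prod (isOpen_univ.prod (isOpen_discrete _))
  have hz : coeff ħ μ ν Φ p =ᵐ[vol3.restrict U] fun _ => 0 := by
    refine (ae_restrict_iff' hU.measurableSet).2 ?_
    filter_upwards [rep_apply h ħ μ ν ξ, hξ, Lp.coeFn_zero ℂ 2 vol3] with v h1 h2 h3 hv
    obtain ⟨hv1, -, hv3⟩ := hv
    rw [Set.mem_singleton_iff] at hv3
    rw [h0, zero_apply, h3] at h1
    have h4 : HasSum (fun q : ℤ => Φ (v.1 - ħ * (q - 2 * v.2.2) * μ)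
        (v.2.1 - ((ħ * (q - 2 * v.2.2) * ν : ℝ) : UnitAddCircle)) q * ξ (v.1, v.2.1, v.2.2 - q))
        (coeff ħ μ ν Φ p v) := by
      convert! hasSum_single (f := fun q : ℤ => Φ (v.1 - ħ * (q - 2 * v.2.2) * μ)
        (v.2.1 - ((ħ * (q - 2 * v.2.2) * ν : ℝ) : UnitAddCircle)) q * ξ (v.1, v.2.1, v.2.2 - q))
        p ?_ using 1
      · rw [h2, Set.indicator_of_mem, mul_one]
        · rfl
        · exact ⟨Set.Ioo_subset_Icc_self hv1, Set.mem_univ _, by simp [hv3]⟩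
      · intro q hq
        rw [h2, Set.indicator_of_notMem, mul_zero]
        rintro ⟨-, -, hq'⟩
        simp only [Set.mem_singleton_iff] at hq'
        omega
    exact h4.unique h1
  have key := Measure.eqOn_open_of_ae_eq hz hU (h.continuous_coeff p).continuousOn
    continuousOn_const
  have hmem : (x - ħ * p * μ, y - ((ħ * p * ν : ℝ) : UnitAddCircle), p) ∈ U := by
    refine ⟨?_, Set.mem_univ _, rfl⟩
    have := neg_abs_le (x - ħ * p * μ)
    have := le_abs_self (x - ħ * p * μ)
    constructor <;> simp only [N] <;> linarith
  have := key hmem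
  simp only [coeff] at this
  refine Eq.trans ?_ this
  congr 1
  · ring
  · rw [sub_sub, ← AddCircle.coe_add]
    have : ħ * p * ν + ħ * (p - 2 * p) * ν = 0 := by ring
    rw [this]
    simp

theorem SA.op_injective : Function.Injective (SA.op : SA c ħ μ ν → _) := by
  intro φ ψ h
  have h0 : (φ - ψ).op = 0 := by rw [SA.op_sub, h, sub_self]
  exact sub_eq_zero.1 (Subtype.ext (eq_zero_of_rep_eq_zero _ h0))

/-! ## The order unit space -/

theorem SA.le_def (φ ψ : SA c ħ μ ν) : φ ≤ ψ ↔ φ.op ≤ ψ.op := Iff.rfl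

theorem SA.op_smul_one (r : ℝ) : (r • SA.one c ħ μ ν).op = (r : ℂ) • 1 := by
  rw [SA.op_complex_smul, SA.op_one]

theorem SA.le_smul_one_iff (φ : SA c ħ μ ν) (r : ℝ) :
    φ ≤ r • SA.one c ħ μ ν ↔ ∀ ξ : Hilb, (inner ℂ (φ.op ξ) ξ).re ≤ r * ‖ξ‖ ^ 2 := by
  rw [SA.le_def, SA.op_smul_one]
  exact le_smul_one_iff_inner_le φ.op_isSymmetric r

theorem SA.le_norm_smul_one (φ : SA c ħ μ ν) : φ ≤ ‖φ.op‖ • SA.one c ħ μ ν := by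
  rw [SA.le_smul_one_iff]
  intro ξ
  calc (inner ℂ (φ.op ξ) ξ).re ≤ ‖φ.op ξ‖ * ‖ξ‖ := re_inner_le_norm (𝕜 := ℂ) _ _
    _ ≤ ‖φ.op‖ * ‖ξ‖ * ‖ξ‖ := by gcongr; exact φ.op.le_opNorm ξ
    _ = _ := by ring

theorem SA.neg_norm_smul_one_le (φ : SA c ħ μ ν) : -(‖φ.op‖ • SA.one c ħ μ ν) ≤ φ := by
  have h : (-φ).op ≤ (‖(-φ).op‖ • SA.one c ħ μ ν).op := SA.le_norm_smul_one (-φ)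
  rw [SA.op_neg, norm_neg] at h
  rw [SA.le_def, SA.op_neg]
  exact neg_le_of_loewner_neg_le h

theorem SA.isOrderUnitSpace : IsOrderUnitSpace (SA.one c ħ μ ν) where
  antisymm a b h h' := SA.op_injective (le_antisymm h h')
  add_le_add a b d h := by
    rw [SA.le_def, SA.op_add, SA.op_add]
    exact add_le_add_of_loewner_le h _
  smul_le_smul a b r hr h := by
    rw [SA.le_def, SA.op_complex_smul, SA.op_complex_smul]
    exact smul_le_smul_of_loewner_le h hr
  order_unit a := ⟨_, SA.le_norm_smul_one a⟩
  archimedean a h := by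
    have : a ≤ (0 : ℝ) • SA.one c ħ μ ν := by
      rw [SA.le_smul_one_iff]
      intro ξ
      rw [zero_mul]
      refine le_of_forall_pos_le_add fun ε hε => ?_
      have h1 := (SA.le_smul_one_iff a _).1 (h (ε / (‖ξ‖ ^ 2 + 1)) (by positivity)) ξ
      have h2 : ε / (‖ξ‖ ^ 2 + 1) * ‖ξ‖ ^ 2 ≤ ε := by
        rw [div_mul_eq_mul_div, div_le_iff₀ (by positivity)]
        nlinarith
      linarith
    rwa [zero_smul] at this

/-! ### Order unit norm and states -/

theorem SA.one_ne_zero : SA.one c ħ μ ν ≠ 0 := by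
  intro h
  have : oneFn 0 0 0 = 0 := congrFun (congrFun (congrFun (congrArg Subtype.val h) 0) 0) 0
  simp [oneFn] at this

/-- Nontriviality of the Hilbert space follows from faithfulness of `π`, since `I ≠ 0` acts as `1`.
-/
theorem norm_one_hilb : ‖(1 : Hilb →L[ℂ] Hilb)‖ = 1 := by
  have : (1 : Hilb →L[ℂ] Hilb) ≠ 0 := by
    rw [← SA.op_one 0 0 0 0]
    intro h
    exact SA.one_ne_zero (SA.op_injective (h.trans (map_zero (SA.opₗ 0 0 0 0)).symm))
  have : Nontrivial Hilb := by
    by_contra hn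
    rw [not_nontrivial_iff_subsingleton] at hn
    exact this (Subsingleton.elim _ _)
  exact norm_one

theorem SA.orderUnitNorm_le (φ : SA c ħ μ ν) : orderUnitNorm (SA.one c ħ μ ν) φ ≤ ‖φ.op‖ := by
  refine csInf_le ⟨0, ?_⟩ ⟨SA.neg_norm_smul_one_le φ, SA.le_norm_smul_one φ⟩
  rintro r ⟨h1, h2⟩
  by_contra! hr
  have h3 : -((r • SA.one c ħ μ ν).op) ≤ (r • SA.one c ħ μ ν).op := by
    rw [← SA.op_neg]; exact h1.trans h2
  rw [SA.op_smul_one] at h3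
  rcases eq_zero_or_nonneg_of_neg_smul_one_le h3 with h | h
  · have := norm_one_hilb
    rw [h, norm_zero] at this
    exact zero_ne_one this
  · linarith

theorem SA.abs_state_le (f : SA c ħ μ ν →ₗ[ℝ] ℝ) (hf : IsState (SA.one c ħ μ ν) f)
    (φ : SA c ħ μ ν) : |f φ| ≤ ‖φ.op‖ := by
  -- Normalizing by some `t > ‖π(φ)‖` avoids dividing by a zero norm.
  refine le_of_forall_gt_imp_ge_of_dense fun t ht => ?_
  have ht0 : 0 < t := (norm_nonneg _).trans_lt ht
  have h1 : |f (t⁻¹ • φ)| ≤ 1 := by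
    refine hf.2.1 ⟨_, (SA.orderUnitNorm_le _).trans ?_, rfl⟩
    rw [SA.op_complex_smul, norm_smul, Complex.norm_real, norm_inv, Real.norm_of_nonneg ht0.le,
      inv_mul_le_iff₀ ht0]
    linarith
  rwa [map_smul, smul_eq_mul, abs_mul, abs_of_pos (inv_pos.2 ht0), inv_mul_le_iff₀ ht0,
    mul_one] at h1

end QHM

namespace QHM

/-! ## The norm `‖·‖_{∞,∞,1}` -/

/-- `sup_{x,y} |Φ(x, y, p)|`. -/
noncomputable def supE (Φ : Fn) (p : ℤ) : ℝ≥0∞ := ⨆ (x : ℝ) (y : UnitAddCircle), ‖Φ x y p‖ₑ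

theorem norm₁_eq (Φ : Fn) : norm₁ Φ = ∑' p, supE Φ p := rfl

theorem le_supE (Φ : Fn) (x : ℝ) (y : UnitAddCircle) (p : ℤ) : ‖Φ x y p‖ₑ ≤ supE Φ p :=
  le_iSup₂ (f := fun x y => ‖Φ x y p‖ₑ) x y

theorem supE_le {Φ : Fn} {p : ℤ} {B : ℝ≥0∞} (h : ∀ x y, ‖Φ x y p‖ₑ ≤ B) : supE Φ p ≤ B :=
  iSup₂_le h

theorem supE_mul_of_eq {Φ Ψ : Fn} {p : ℤ} (a : ℂ) (h : ∀ x y, Ψ x y p = a * Φ x y p) :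
    supE Ψ p = ‖a‖ₑ * supE Φ p := by
  simp only [supE, h, enorm_mul, ENNReal.mul_iSup]

theorem norm₁_add_le (Φ Ψ : Fn) : norm₁ (Φ + Ψ) ≤ norm₁ Φ + norm₁ Ψ := by
  simp only [norm₁_eq]
  rw [← ENNReal.tsum_add]
  exact ENNReal.tsum_le_tsum fun p => supE_le fun x y =>
    (enorm_add_le _ _).trans (add_le_add (le_supE Φ x y p) (le_supE Ψ x y p))

theorem norm₁_smul (a : ℂ) (Φ : Fn) : norm₁ (a • Φ) = ‖a‖ₑ * norm₁ Φ := by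
  simp only [norm₁_eq]
  rw [← ENNReal.tsum_mul_left]
  exact tsum_congr fun p => supE_mul_of_eq a fun x y => rfl

theorem enorm_le_norm₁ (Φ : Fn) (x : ℝ) (y : UnitAddCircle) (p : ℤ) : ‖Φ x y p‖ₑ ≤ norm₁ Φ :=
  (le_supE Φ x y p).trans (ENNReal.le_tsum p)

theorem norm₁_eq_zero_iff (Φ : Fn) : norm₁ Φ = 0 ↔ Φ = 0 := by
  constructor
  · intro h
    funext x y p
    have := enorm_le_norm₁ Φ x y p
    rw [h] at this
    exact enorm_eq_zero.1 (le_antisymm this zero_le)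
  · rintro rfl
    simp [norm₁]

variable {c : ℕ} {ħ μ ν : ℝ}

/-- Each term of `π(Φ)` is an isometric shift followed by multiplication by a function bounded by
`supE Φ q`. -/
theorem enorm_rep_le {Φ : Fn} (h : IsSc c Φ) : ‖rep h ħ μ ν‖ₑ ≤ norm₁ Φ := by
  have h1 : ‖rep h ħ μ ν‖ₑ ≤ ∑' q, ‖repTerm h ħ μ ν q‖ₑ := by
    have hs := repTerm_summable h ħ μ ν
    have h2 : ‖rep h ħ μ ν‖ ≤ ∑' q, ‖repTerm h ħ μ ν q‖ := norm_tsum_le_tsum_norm hs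
    simp only [← ofReal_norm]
    rw [← ENNReal.ofReal_tsum_of_nonneg (fun _ => norm_nonneg _) hs]
    exact ENNReal.ofReal_le_ofReal h2
  refine h1.trans (ENNReal.tsum_le_tsum fun q => ?_)
  obtain ⟨b, _, hb⟩ := h.exists_bound
  have hfin : supE Φ q ≠ ⊤ := by
    refine ((supE_le fun x y => ?_).trans_lt (ENNReal.ofReal_lt_top (r := b q))).ne
    rw [← ofReal_norm]
    exact ENNReal.ofReal_le_ofReal (hb x y q)
  change _ ≤ supE Φ q
  rw [← ofReal_norm, ENNReal.ofReal_le_iff_le_toReal hfin]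
  refine norm_repTerm_le h ħ μ ν q fun x y => ?_
  rw [← ENNReal.ofReal_le_iff_le_toReal hfin, ofReal_norm]
  exact le_supE Φ x y q

/-- The tail of `‖Ψ‖_{∞,∞,1}` is controlled by `δ₃ Ψ`. -/
theorem norm₁_le_sum_add (Ψ : Fn) {N : ℕ} (hN : N ≠ 0) :
    norm₁ Ψ ≤ ∑ p ∈ Finset.Ioo (-N : ℤ) N, supE Ψ p + (N : ℝ≥0∞)⁻¹ * norm₁ (δ₃ Ψ) := by
  have hsum : ∑ p ∈ Finset.Ioo (-N : ℤ) N, supE Ψ p =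
      ∑' p, (if p ∈ Finset.Ioo (-N : ℤ) N then supE Ψ p else 0) := by
    rw [tsum_eq_sum (s := Finset.Ioo (-N : ℤ) N) (fun p hp => by simp [hp])]
    exact Finset.sum_congr rfl fun p hp => by simp only [hp, if_true]
  rw [hsum, norm₁_eq, norm₁_eq, ← ENNReal.tsum_mul_left, ← ENNReal.tsum_add]
  refine ENNReal.tsum_le_tsum fun p => ?_
  by_cases hp : p ∈ Finset.Ioo (-N : ℤ) N
  · rw [if_pos hp]
    exact le_self_add
  · rw [if_neg hp, zero_add, supE_mul_of_eq (Φ := Ψ) (Ψ := δ₃ Ψ)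
      (2 * Real.pi * Complex.I * p) (fun x y => rfl), ← mul_assoc]
    refine le_mul_of_one_le_left zero_le ?_
    -- Outside the window `|p| ≥ N`; the extra factor `2π` is discarded.
    have h1 : (N : ℝ≥0∞) ≤ ‖(2 * Real.pi * Complex.I * p : ℂ)‖ₑ := by
      have h2 : (N : ℝ) ≤ |(p : ℝ)| := by
        have : (N : ℤ) ≤ |p| := by
          rw [Finset.mem_Ioo, not_and_or, not_lt, not_lt] at hp
          rw [le_abs]
          omega
        exact_mod_cast this
      rw [← ofReal_norm, ← ENNReal.ofReal_natCast]
      refine ENNReal.ofReal_le_ofReal ?_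
      simp only [norm_mul, Complex.norm_I, Complex.norm_real, Complex.norm_ofNat,
        Complex.norm_intCast, Real.norm_of_nonneg Real.pi_pos.le, mul_one]
      nlinarith [Real.pi_gt_three, abs_nonneg (p : ℝ)]
    calc (1 : ℝ≥0∞) = (N : ℝ≥0∞)⁻¹ * N :=
          (ENNReal.inv_mul_cancel (by exact_mod_cast hN) (ENNReal.natCast_ne_top N)).symm
      _ ≤ _ := by gcongr

theorem norm₁_ne_top_of_decay {G : Fn} (hper : ∀ (k : ℤ) x y p, ‖G (x + k) y p‖ = ‖G x y p‖)
    {C : ℝ} (hC : ∀ x ∈ Set.Icc (0 : ℝ) 1, ∀ y (p : ℤ), ((p : ℝ) ^ 2 + 1) * ‖G x y p‖ ≤ C) :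
    norm₁ G ≠ ⊤ := by
  have hs : Summable fun p : ℤ => C * (1 / ((p : ℝ) ^ 2 + 1)) := by
    refine Summable.mul_left _ ?_
    have hs : Summable fun p : ℤ => 1 / (p : ℝ) ^ 2 :=
      Real.summable_one_div_int_pow.mpr (by norm_num)
    refine Summable.of_norm_bounded_eventually hs ?_
    filter_upwards [(Set.finite_singleton (0 : ℤ)).compl_mem_cofinite] with p hp
    have hp' : (p : ℝ) ≠ 0 := by exact_mod_cast hp
    rw [Real.norm_of_nonneg (by positivity)]
    exact one_div_le_one_div_of_le (by positivity) (by linarith)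
  refine ((ENNReal.tsum_le_tsum fun p => supE_le fun x y => ?_).trans_lt
    hs.tsum_ofReal_lt_top).ne
  rw [← ofReal_norm]
  refine ENNReal.ofReal_le_ofReal ?_
  rw [← Int.fract_add_floor x, hper, mul_one_div, le_div_iff₀ (by positivity), mul_comm]
  exact hC _ ⟨Int.fract_nonneg x, (Int.fract_lt_one x).le⟩ y p

/-! ## The derivations -/

theorem norm_fourier_eq_one (n : ℤ) (y : UnitAddCircle) : ‖(fourier n y : ℂ)‖ = 1 := by
  rw [fourier_apply]; exact Circle.norm_coe _

theorem IsSc.differentiable_x {Φ : Fn} (h : IsSc c Φ) (y : UnitAddCircle) (p : ℤ) :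
    Differentiable ℝ fun t : ℝ => Φ t y p := by
  obtain ⟨s, rfl⟩ := QuotientAddGroup.mk_surjective y
  exact ((h.smooth p).differentiable (by simp)).comp
    (differentiable_id.prodMk (differentiable_const s))

theorem IsSc.differentiable_y {Φ : Fn} (h : IsSc c Φ) (x : ℝ) (p : ℤ) :
    Differentiable ℝ fun t : ℝ => Φ x (t : UnitAddCircle) p :=
  ((h.smooth p).differentiable (by simp)).comp ((differentiable_const x).prodMk differentiable_id)

theorem IsSc.hasDerivAt_y {Φ : Fn} (h : IsSc c Φ) (x s : ℝ) (p : ℤ) :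
    HasDerivAt (fun t : ℝ => Φ x (t : UnitAddCircle) p) (dy Φ x s p) s := by
  have h1 := (h.differentiable_y x p s).hasDerivAt
  have h2 : dy Φ x s p = deriv (fun t : ℝ => Φ x (t : UnitAddCircle) p) s := by
    simp only [dy]
    rw [← add_zero s, ← deriv_comp_const_add]
    simp
  rwa [h2]

theorem IsSc.dx_quasiperiodic {Φ : Fn} (h : IsSc c Φ) (k : ℤ) (x : ℝ) (y : UnitAddCircle)
    (p : ℤ) : dx Φ (x + k) y p = fourier ((c : ℤ) * k * p) y * dx Φ x y p := by
  simp only [dx]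
  rw [← deriv_comp_add_const (fun t : ℝ => Φ t y p) (k : ℝ)]
  simp only [h.quasiperiodic]
  exact deriv_const_mul_field _

theorem IsSc.dy_quasiperiodic {Φ : Fn} (h : IsSc c Φ) (k : ℤ) (x : ℝ) (y : UnitAddCircle)
    (p : ℤ) : dy Φ (x + k) y p = fourier ((c : ℤ) * k * p) y *
      (dy Φ x y p + 2 * Real.pi * Complex.I * (c * k * p) * Φ x y p) := by
  obtain ⟨s, rfl⟩ := QuotientAddGroup.mk_surjective y
  refine (h.hasDerivAt_y (x + k) s p).unique ?_
  simp only [h.quasiperiodic]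
  convert! (hasDerivAt_fourier 1 ((c : ℤ) * k * p) s).mul (h.hasDerivAt_y x s p) using 1
  push_cast
  ring

/-- Differentiating the phase `e(ckpy)` in `y` creates `2πi ckp Φ`, exactly what replacing `x` by `x
+ k` adds to `2πi c p x Φ`. -/
theorem IsSc.δ₂_quasiperiodic {Φ : Fn} (h : IsSc c Φ) (k : ℤ) (x : ℝ) (y : UnitAddCircle)
    (p : ℤ) : δ₂ c Φ (x + k) y p = fourier ((c : ℤ) * k * p) y * δ₂ c Φ x y p := by
  simp only [δ₂, h.quasiperiodic, h.dy_quasiperiodic]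
  push_cast
  ring

theorem norm_eval_sq_add_one (p : ℤ) :
    ‖(Polynomial.X ^ 2 + 1 : Polynomial ℂ).eval (p : ℂ)‖ = (p : ℝ) ^ 2 + 1 := by
  have : (Polynomial.X ^ 2 + 1 : Polynomial ℂ).eval (p : ℂ) = (((p : ℝ) ^ 2 + 1 : ℝ) : ℂ) := by
    simp
  rw [this, Complex.norm_real, Real.norm_of_nonneg (by positivity)]

/-- The weight `p² + 1` secures summability over `p`; `P` absorbs the factors of `p` in `δ₂` and
`δ₃`. -/
theorem IsSc.exists_decay {Φ : Fn} (h : IsSc c Φ) (m n : ℕ) (P : Polynomial ℂ) :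
    ∃ C : ℝ, ∀ x ∈ Set.Icc (0 : ℝ) 1, ∀ y (p : ℤ), ((p : ℝ) ^ 2 + 1) * ‖P.eval (p : ℂ) *
      (dx^[m] (dy^[n] Φ)) x y p‖ ≤ C := by
  obtain ⟨C, hC⟩ := h.decay ((Polynomial.X ^ 2 + 1) * P) m n (Set.Icc 0 1 ×ˢ Set.univ)
    (isCompact_Icc.prod isCompact_univ)
  refine ⟨C, fun x hx y p => ?_⟩
  have := hC (x, y) ⟨hx, Set.mem_univ _⟩ p
  rwa [Polynomial.eval_mul, mul_assoc, norm_mul, norm_eval_sq_add_one] at this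

theorem IsSc.norm₁_δ₁_ne_top {Φ : Fn} (h : IsSc c Φ) : norm₁ (δ₁ Φ) ≠ ⊤ := by
  obtain ⟨C, hC⟩ := h.exists_decay 1 0 1
  refine norm₁_ne_top_of_decay (C := C) (fun k x y p => ?_) fun x hx y p => ?_
  · simp only [δ₁, norm_neg, h.dx_quasiperiodic, norm_mul, norm_fourier_eq_one, one_mul]
  · simpa [δ₁] using hC x hx y p

theorem IsSc.norm₁_δ₃_ne_top {Φ : Fn} (h : IsSc c Φ) : norm₁ (δ₃ Φ) ≠ ⊤ := by
  obtain ⟨C, hC⟩ := h.exists_decay 0 0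
    (Polynomial.C (2 * Real.pi * Complex.I) * Polynomial.X)
  refine norm₁_ne_top_of_decay (C := C) (fun k x y p => ?_) fun x hx y p => ?_
  · simp only [δ₃, h.quasiperiodic, norm_mul, norm_fourier_eq_one, one_mul]
  · simpa [δ₃] using hC x hx y p

theorem IsSc.norm₁_δ₂_ne_top {Φ : Fn} (h : IsSc c Φ) : norm₁ (δ₂ c Φ) ≠ ⊤ := by
  obtain ⟨C, hC⟩ := h.exists_decay 0 0
    (Polynomial.C (2 * Real.pi * Complex.I * c) * Polynomial.X)
  obtain ⟨D, hD⟩ := h.exists_decay 0 1 1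
  refine norm₁_ne_top_of_decay (C := C + D) (fun k x y p => ?_) fun x hx y p => ?_
  · rw [h.δ₂_quasiperiodic, norm_mul, norm_fourier_eq_one, one_mul]
  · have h1 := hC x hx y p
    have h2 := hD x hx y p
    simp only [Polynomial.eval_mul, Polynomial.eval_C, Polynomial.eval_X, Polynomial.eval_one,
      one_mul, Function.iterate_zero, Function.iterate_one, id_eq] at h1 h2
    have h3 : ‖2 * Real.pi * Complex.I * c * p * x * Φ x y p‖ ≤
        ‖2 * Real.pi * Complex.I * c * p * Φ x y p‖ := by
      rw [mul_right_comm _ (x : ℂ), norm_mul _ (x : ℂ), Complex.norm_real,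
        Real.norm_of_nonneg hx.1]
      exact mul_le_of_le_one_right (norm_nonneg _) hx.2
    calc ((p : ℝ) ^ 2 + 1) * ‖δ₂ c Φ x y p‖
        ≤ ((p : ℝ) ^ 2 + 1) * (‖2 * Real.pi * Complex.I * c * p * Φ x y p‖ + ‖dy Φ x y p‖) := by
          gcongr
          exact (norm_sub_le _ _).trans (add_le_add h3 le_rfl)
      _ ≤ C + D := by rw [mul_add]; exact add_le_add h1 h2

/-! ## The seminorm `L` -/

theorem lipE_ne_top (φ : SA c ħ μ ν) : lipE φ ≠ ⊤ :=
  (max_lt (max_lt φ.2.1.norm₁_δ₁_ne_top.lt_top φ.2.1.norm₁_δ₂_ne_top.lt_top)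
    φ.2.1.norm₁_δ₃_ne_top.lt_top).ne

theorem δ₁_add {Φ Ψ : Fn} (h : IsSc c Φ) (h' : IsSc c Ψ) : δ₁ (Φ + Ψ) = δ₁ Φ + δ₁ Ψ := by
  funext x y p
  simp only [δ₁, dx_add h.smooth h'.smooth, Pi.add_apply]
  ring

theorem δ₂_add {Φ Ψ : Fn} (h : IsSc c Φ) (h' : IsSc c Ψ) :
    δ₂ c (Φ + Ψ) = δ₂ c Φ + δ₂ c Ψ := by
  funext x y p
  simp only [δ₂, dy_add h.smooth h'.smooth, Pi.add_apply]
  ring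

theorem δ₃_add (Φ Ψ : Fn) : δ₃ (Φ + Ψ) = δ₃ Φ + δ₃ Ψ := by
  funext x y p
  simp only [δ₃, Pi.add_apply]
  ring

theorem δ₁_smul (a : ℂ) (Φ : Fn) : δ₁ (a • Φ) = a • δ₁ Φ := by
  funext x y p
  simp only [δ₁, dx_smul, Pi.smul_apply, smul_neg]

theorem δ₂_smul (a : ℂ) (Φ : Fn) : δ₂ c (a • Φ) = a • δ₂ c Φ := by
  funext x y p
  simp only [δ₂, dy_smul, Pi.smul_apply, smul_eq_mul]
  ring

theorem δ₃_smul (a : ℂ) (Φ : Fn) : δ₃ (a • Φ) = a • δ₃ Φ := by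
  funext x y p
  simp only [δ₃, Pi.smul_apply, smul_eq_mul]
  ring

theorem SA.fn_smul (r : ℝ) (φ : SA c ħ μ ν) : (r • φ).fn = (r : ℂ) • φ.fn := by
  funext x y p
  exact Complex.real_smul

theorem lipE_add_le (φ ψ : SA c ħ μ ν) : lipE (φ + ψ) ≤ lipE φ + lipE ψ := by
  have e : (φ + ψ).fn = φ.fn + ψ.fn := rfl
  have h : IsSc c φ.fn := φ.2.1
  have h' : IsSc c ψ.fn := ψ.2.1
  simp only [lipE, e, δ₁_add h h', δ₂_add h h', δ₃_add]
  refine max_le (max_le ?_ ?_) ?_ <;> refine (norm₁_add_le _ _).trans (add_le_add ?_ ?_) <;> simp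

theorem lipE_smul (r : ℝ) (φ : SA c ħ μ ν) : lipE (r • φ) = ‖r‖ₑ * lipE φ := by
  have hr : ‖(r : ℂ)‖ₑ = ‖r‖ₑ := by rw [← ofReal_norm, ← ofReal_norm, Complex.norm_real]
  simp only [lipE, SA.fn_smul, δ₁_smul, δ₂_smul, δ₃_smul, norm₁_smul, hr, mul_max]

theorem lip_add_le (φ ψ : SA c ħ μ ν) : lip (φ + ψ) ≤ lip φ + lip ψ := by
  rw [lip, lip, lip, ← ENNReal.toReal_add (lipE_ne_top φ) (lipE_ne_top ψ)]
  exact ENNReal.toReal_mono (ENNReal.add_ne_top.2 ⟨lipE_ne_top φ, lipE_ne_top ψ⟩)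
    (lipE_add_le φ ψ)

theorem lip_smul (r : ℝ) (φ : SA c ħ μ ν) : lip (r • φ) = |r| * lip φ := by
  rw [lip, lipE_smul, ENNReal.toReal_mul, toReal_enorm, Real.norm_eq_abs, lip]

theorem lip_sub_le (φ ψ : SA c ħ μ ν) : lip (φ - ψ) ≤ lip φ + lip ψ := by
  have h := lip_add_le φ ((-1 : ℝ) • ψ)
  rw [lip_smul, neg_one_smul, ← sub_eq_add_neg] at h
  simpa using h

/-! ### Pointwise bounds from `L` -/

theorem norm_le_lip_of_le {G : Fn} {φ : SA c ħ μ ν} (hG : norm₁ G ≤ lipE φ) (x : ℝ)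
    (y : UnitAddCircle) (p : ℤ) : ‖G x y p‖ ≤ lip φ := by
  rw [← toReal_enorm]
  exact ENNReal.toReal_mono (lipE_ne_top φ) ((enorm_le_norm₁ G x y p).trans hG)

theorem norm_dx_le_lip (φ : SA c ħ μ ν) (x : ℝ) (y : UnitAddCircle) (p : ℤ) :
    ‖dx φ.fn x y p‖ ≤ lip φ := by
  rw [← norm_neg]
  exact norm_le_lip_of_le (G := δ₁ φ.fn) (le_sup_left.trans le_sup_left) x y p

theorem norm_δ₃_le_lip (φ : SA c ħ μ ν) (x : ℝ) (y : UnitAddCircle) (p : ℤ) :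
    ‖δ₃ φ.fn x y p‖ ≤ lip φ :=
  norm_le_lip_of_le le_sup_right x y p

/-- Here `∂/∂y = c x δ₃ - δ₂`. The growth in `x` is harmless on the unit square. -/
theorem norm_dy_le_lip (φ : SA c ħ μ ν) (x : ℝ) (y : UnitAddCircle) (p : ℤ) :
    ‖dy φ.fn x y p‖ ≤ (1 + c * |x|) * lip φ := by
  have h1 := norm_le_lip_of_le (G := δ₂ c φ.fn) (φ := φ) (le_sup_right.trans le_sup_left) x y p
  have h3 := norm_δ₃_le_lip φ x y p
  have e : dy φ.fn x y p = (c * x : ℂ) * δ₃ φ.fn x y p - δ₂ c φ.fn x y p := by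
    simp only [δ₂, δ₃]; ring
  rw [e]
  refine (norm_sub_le _ _).trans ?_
  rw [norm_mul, norm_mul, Complex.norm_real, Complex.norm_natCast, Real.norm_eq_abs]
  nlinarith [mul_le_mul_of_nonneg_left h3 (by positivity : (0 : ℝ) ≤ c * |x|)]

theorem norm_fn_le_lip (φ : SA c ħ μ ν) (x : ℝ) (y : UnitAddCircle) {p : ℤ} (hp : p ≠ 0) :
    ‖φ.fn x y p‖ ≤ lip φ := by
  refine le_trans ?_ (norm_δ₃_le_lip φ x y p)
  simp only [δ₃, norm_mul, Complex.norm_I, Complex.norm_real, Complex.norm_ofNat,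
    Complex.norm_intCast, Real.norm_of_nonneg Real.pi_pos.le, mul_one]
  have h1 : (1 : ℝ) ≤ |(p : ℝ)| := by exact_mod_cast Int.one_le_abs hp
  refine le_mul_of_one_le_left (norm_nonneg _) ?_
  nlinarith [Real.pi_gt_three]

theorem norm_sub_le_lip_x (φ : SA c ħ μ ν) (x x' : ℝ) (y : UnitAddCircle) (p : ℤ) :
    ‖φ.fn x y p - φ.fn x' y p‖ ≤ lip φ * |x - x'| :=
  convex_univ.norm_image_sub_le_of_norm_deriv_le
    (fun t _ => φ.2.1.differentiable_x y p t) (fun t _ => norm_dx_le_lip φ t y p)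
    (Set.mem_univ x') (Set.mem_univ x)

theorem norm_sub_le_lip_y (φ : SA c ħ μ ν) (x t t' : ℝ) (p : ℤ) :
    ‖φ.fn x (t : UnitAddCircle) p - φ.fn x (t' : UnitAddCircle) p‖ ≤
      (1 + c * |x|) * lip φ * |t - t'| :=
  convex_univ.norm_image_sub_le_of_norm_hasDerivWithin_le
    (fun t _ => (φ.2.1.hasDerivAt_y x t p).hasDerivWithinAt) (fun t _ => norm_dy_le_lip φ x t p)
    (Set.mem_univ t') (Set.mem_univ t)

/-- Up to a phase, the values of `φ` are attained on the unit square. -/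
theorem exists_unit_square (x : ℝ) (y : UnitAddCircle) :
    ∃ x' ∈ Set.Icc (0 : ℝ) 1, ∃ t ∈ Set.Icc (0 : ℝ) 1, ∀ {Φ : Fn}, IsSc c Φ → ∀ p : ℤ,
      ‖Φ x y p‖ = ‖Φ x' (t : UnitAddCircle) p‖ ∧ Φ x y 0 = Φ x' (t : UnitAddCircle) 0 := by
  obtain ⟨t, ht, rfl⟩ : ∃ t ∈ Set.Icc (0 : ℝ) 1, (t : UnitAddCircle) = y := by
    obtain ⟨s, rfl⟩ := QuotientAddGroup.mk_surjective y
    refine ⟨Int.fract s, ⟨Int.fract_nonneg s, (Int.fract_lt_one s).le⟩, ?_⟩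
    refine (QuotientAddGroup.eq).2 ⟨⌊s⌋, ?_⟩
    change ⌊s⌋ • (1 : ℝ) = -Int.fract s + s
    rw [zsmul_one]
    linarith [Int.fract_add_floor s]
  refine ⟨Int.fract x, ⟨Int.fract_nonneg x, (Int.fract_lt_one x).le⟩, t, ht, fun h p => ?_⟩
  constructor
  · rw [← Int.fract_add_floor x, h.quasiperiodic, norm_mul, norm_fourier_eq_one, one_mul,
      Int.fract_add_floor]
  -- In mode `0` the phase is `1`.
  · rw [← Int.fract_add_floor x, h.quasiperiodic, Int.fract_add_floor]
    simp

theorem norm_fn_zero_sub_le (φ : SA c ħ μ ν) (x : ℝ) (y : UnitAddCircle) :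
    ‖φ.fn x y 0 - φ.fn 0 0 0‖ ≤ 2 * lip φ := by
  obtain ⟨x', hx, t, ht, h⟩ := exists_unit_square (c := c) x y
  have e : φ.fn x y 0 = φ.fn x' t 0 := (h φ.2.1 0).2
  rw [e]
  have h1 := norm_sub_le_lip_x φ x' 0 t 0
  -- Moving in `y` along `x = 0` makes the bound independent of `c`.
  have h2 := norm_sub_le_lip_y φ 0 t 0 0
  have hL : 0 ≤ lip φ := ENNReal.toReal_nonneg
  rw [sub_zero, abs_of_nonneg hx.1] at h1
  rw [sub_zero, abs_of_nonneg ht.1, abs_zero, mul_zero, add_zero, one_mul, AddCircle.coe_zero] at h2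
  have h3 := norm_sub_le_norm_sub_add_norm_sub (φ.fn x' t 0) (φ.fn 0 t 0) (φ.fn 0 0 0)
  have h4 := mul_le_of_le_one_right hL hx.2
  have h5 := mul_le_of_le_one_right hL ht.2
  linarith

/-- Self-adjointness fixes mode `0` under conjugation; hence the scalar to subtract lies in `ℝ`. -/
theorem fn_zero_real (φ : SA c ħ μ ν) (x : ℝ) (y : UnitAddCircle) :
    (((φ.fn x y 0).re : ℝ) : ℂ) = φ.fn x y 0 := by
  refine Complex.conj_eq_iff_re.1 ?_
  have := congrFun (congrFun (congrFun φ.2.2 x) y) 0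
  simp only [invol, neg_zero] at this
  exact this

theorem lip_one : lip (SA.one c ħ μ ν) = 0 := by
  have h1 : δ₁ oneFn = 0 := by funext x y p; simp [δ₁, dx, oneFn]
  have h2 : δ₂ c oneFn = 0 := by
    funext x y p
    by_cases hp : p = 0 <;> simp [δ₂, dy, oneFn, hp]
  have h3 : δ₃ oneFn = 0 := by
    funext x y p
    by_cases hp : p = 0 <;> simp [δ₃, oneFn, hp]
  have h0 : norm₁ 0 = 0 := (norm₁_eq_zero_iff 0).2 rfl
  change (norm₁ (δ₁ oneFn) ⊔ norm₁ (δ₂ c oneFn) ⊔ norm₁ (δ₃ oneFn)).toReal = 0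
  simp [h1, h2, h3, h0]

/-- If `L` vanishes, `δ₃` kills the nonzero modes and the oscillation bound makes mode `0` a real
constant. -/
theorem lip_eq_zero_iff (φ : SA c ħ μ ν) : lip φ = 0 ↔ ∃ r : ℝ, φ = r • SA.one c ħ μ ν := by
  constructor
  · intro h
    refine ⟨(φ.fn 0 0 0).re, Subtype.ext ?_⟩
    change φ.fn = ((φ.fn 0 0 0).re • SA.one c ħ μ ν).fn
    rw [SA.fn_smul, fn_zero_real]
    funext x y p
    change φ.fn x y p = φ.fn 0 0 0 * oneFn x y p
    by_cases hp : p = 0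
    · subst hp
      have := norm_fn_zero_sub_le φ x y
      rw [h, mul_zero, norm_le_zero_iff, sub_eq_zero] at this
      simp [this, oneFn]
    · have := norm_fn_le_lip φ x y hp
      rw [h, norm_le_zero_iff] at this
      simp [this, oneFn, hp]
  · rintro ⟨r, rfl⟩
    rw [lip_smul, lip_one, mul_zero]

end QHM

namespace QHM

variable {c : ℕ} {ħ μ ν : ℝ}

/-! ## Boundedness and total boundedness of the unit ball of `L` -/

/-- The window has at most `2N` modes, each of size at most `η`; the tail costs `L/N`. -/
theorem norm_op_le (φ : SA c ħ μ ν) {N : ℕ} (hN : N ≠ 0) {η : ℝ} (hη : 0 ≤ η)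
    (h : ∀ p ∈ Finset.Ioo (-N : ℤ) N, ∀ x y, ‖φ.fn x y p‖ ≤ η) :
    ‖φ.op‖ ≤ 2 * N * η + lip φ / N := by
  have hL : 0 ≤ lip φ := ENNReal.toReal_nonneg
  have hcard : (Finset.Ioo (-N : ℤ) N).card ≤ 2 * N := by
    rw [Int.card_Ioo]; omega
  have h1 : ‖φ.op‖ₑ ≤ ENNReal.ofReal (2 * N * η + lip φ / N) := by
    refine (enorm_rep_le φ.2.1).trans ((norm₁_le_sum_add φ.fn hN).trans ?_)
    rw [ENNReal.ofReal_add (by positivity) (by positivity)]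
    refine add_le_add ?_ ?_
    · calc ∑ p ∈ Finset.Ioo (-N : ℤ) N, supE φ.fn p
          ≤ ∑ p ∈ Finset.Ioo (-N : ℤ) N, ENNReal.ofReal η := by
            refine Finset.sum_le_sum fun p hp => supE_le fun x y => ?_
            rw [← ofReal_norm]
            exact ENNReal.ofReal_le_ofReal (h p hp x y)
        _ = ENNReal.ofReal ((Finset.Ioo (-N : ℤ) N).card * η) := by
            rw [Finset.sum_const, nsmul_eq_mul, ENNReal.ofReal_mul (by positivity),
              ENNReal.ofReal_natCast]
        _ ≤ _ := by
            refine ENNReal.ofReal_le_ofReal (mul_le_mul_of_nonneg_right ?_ hη)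
            exact_mod_cast hcard
    · rw [div_eq_inv_mul, ENNReal.ofReal_mul (by positivity),
        ENNReal.ofReal_inv_of_pos (by positivity), ENNReal.ofReal_natCast, lip,
        ENNReal.ofReal_toReal (lipE_ne_top φ)]
      gcongr
      exact le_sup_right
  rw [← ofReal_norm] at h1
  exact (ENNReal.ofReal_le_ofReal_iff (by positivity)).1 h1

theorem fn_sub_smul_one_apply (φ : SA c ħ μ ν) (r : ℝ) (x : ℝ) (y : UnitAddCircle) :
    (φ - r • SA.one c ħ μ ν).fn x y 0 = φ.fn x y 0 - r := by
  change φ.fn x y 0 - (r • SA.one c ħ μ ν).fn x y 0 = _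
  rw [SA.fn_smul]
  change _ - (r : ℂ) * oneFn x y 0 = _
  simp [oneFn]

/-- With `N = 1` the window is mode `0` alone, and `2·1·2L + L = 5L`. -/
theorem norm_op_sub_le (φ : SA c ħ μ ν) :
    ‖(φ - (φ.fn 0 0 0).re • SA.one c ħ μ ν).op‖ ≤ 5 * lip φ := by
  have hL : 0 ≤ lip φ := ENNReal.toReal_nonneg
  have h2 : lip (φ - (φ.fn 0 0 0).re • SA.one c ħ μ ν) ≤ lip φ := by
    refine (lip_sub_le _ _).trans ?_
    rw [lip_smul, lip_one, mul_zero, add_zero]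
  refine (norm_op_le _ one_ne_zero (η := 2 * lip φ) (by positivity) fun p hp x y => ?_).trans ?_
  · obtain rfl : p = 0 := by
      rw [Finset.mem_Ioo] at hp
      push_cast at hp
      omega
    rw [fn_sub_smul_one_apply, fn_zero_real]
    exact norm_fn_zero_sub_le φ x y
  · push_cast
    linarith

/-- Makes the grid samples bounded. In mode `0`, `|φ(0,0,0)|` is the norm of a scalar operator
within `5L` of `π(φ)`, and oscillation adds `2L`. -/
theorem norm_fn_le (φ : SA c ħ μ ν) (x : ℝ) (y : UnitAddCircle) (p : ℤ) :
    ‖φ.fn x y p‖ ≤ ‖φ.op‖ + 7 * lip φ := by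
  have hL : 0 ≤ lip φ := ENNReal.toReal_nonneg
  by_cases hp : p = 0
  · subst hp
    have h1 : ‖φ.fn 0 0 0‖ ≤ ‖φ.op‖ + 5 * lip φ := by
      have h2 : ((φ.fn 0 0 0).re • SA.one c ħ μ ν).op =
          φ.op - (φ - (φ.fn 0 0 0).re • SA.one c ħ μ ν).op := by rw [SA.op_sub]; abel
      have h3 : ‖φ.fn 0 0 0‖ = ‖((φ.fn 0 0 0).re • SA.one c ħ μ ν).op‖ := by
        rw [SA.op_smul_one, norm_smul, norm_one_hilb, mul_one, fn_zero_real]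
      rw [h3, h2]
      exact (norm_sub_le _ _).trans (add_le_add le_rfl (norm_op_sub_le φ))
    have h4 := norm_fn_zero_sub_le φ x y
    have h5 := norm_le_norm_add_norm_sub' (φ.fn x y 0) (φ.fn 0 0 0)
    linarith
  · have := norm_fn_le_lip φ x y hp
    have := norm_nonneg φ.op
    linarith

theorem exists_grid_near {M : ℕ} (hM : M ≠ 0) {x : ℝ} (hx : x ∈ Set.Icc (0 : ℝ) 1) :
    ∃ i : Fin (M + 1), |x - (i : ℝ) / M| ≤ 1 / M ∧ |((i : ℝ) / M)| ≤ 1 := by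
  have hM0 : (0 : ℝ) < M := by positivity
  have h0 : 0 ≤ x * M := mul_nonneg hx.1 hM0.le
  have h1 := Nat.floor_le h0
  have h2 := Nat.lt_floor_add_one (x * M)
  have h3 : ⌊x * M⌋₊ ≤ M := Nat.floor_le_of_le (mul_le_of_le_one_left hM0.le hx.2)
  refine ⟨⟨⌊x * M⌋₊, by omega⟩, ?_, ?_⟩
  · have e : x - (⌊x * M⌋₊ : ℝ) / M = (x * M - ⌊x * M⌋₊) / M := by field_simp
    simp only [e]
    rw [abs_div, abs_of_pos hM0, div_le_div_iff_of_pos_right hM0, abs_le]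
    constructor <;> linarith
  · rw [abs_div, abs_of_pos hM0, Nat.abs_cast, div_le_one hM0]
    exact_mod_cast h3

/-- An element of `A` is controlled by `L` and its values on a grid in the unit square. -/
theorem norm_fn_le_of_grid (φ : SA c ħ μ ν) {M : ℕ} (hM : M ≠ 0) {p : ℤ} {η : ℝ}
    (h : ∀ i j : Fin (M + 1), ‖φ.fn ((i : ℝ) / M) (((j : ℝ) / M : ℝ) : UnitAddCircle) p‖ ≤ η)
    (x : ℝ) (y : UnitAddCircle) : ‖φ.fn x y p‖ ≤ η + (2 + c) * lip φ / M := by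
  have hL : 0 ≤ lip φ := ENNReal.toReal_nonneg
  obtain ⟨x', hx, t, ht, hxy⟩ := exists_unit_square (c := c) x y
  have e : ‖φ.fn x y p‖ = ‖φ.fn x' t p‖ := (hxy φ.2.1 p).1
  obtain ⟨i, hi, hi1⟩ := exists_grid_near hM hx
  obtain ⟨j, hj, -⟩ := exists_grid_near hM ht
  have h1 := norm_sub_le_lip_x φ x' ((i : ℝ) / M) t p
  have h2 := norm_sub_le_lip_y φ ((i : ℝ) / M) t ((j : ℝ) / M) p
  have h3 : lip φ * |x' - (i : ℝ) / M| ≤ lip φ * (1 / M) := by gcongr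
  have h4 : (1 + c * |(i : ℝ) / M|) * lip φ * |t - (j : ℝ) / M| ≤
      (1 + c * 1) * lip φ * (1 / M) := by gcongr
  have h5 := norm_le_norm_add_norm_sub' (φ.fn x' t p) (φ.fn ((i : ℝ) / M) t p)
  -- The move in `x` costs `L/M`; the move in `y`, at a grid abscissa at most `1`, costs `(1 +
  -- c)L/M`.
  have h6 := norm_le_norm_add_norm_sub' (φ.fn ((i : ℝ) / M) t p)
    (φ.fn ((i : ℝ) / M) (((j : ℝ) / M : ℝ) : UnitAddCircle) p)
  have h7 : lip φ * (1 / M) + (1 + c * 1) * lip φ * (1 / M) = (2 + c) * lip φ / M := by ring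
  rw [e]
  linarith [h i j]

theorem totallyBounded_lip_ball (R : ℝ) : TotallyBounded
    ((fun φ : SA c ħ μ ν => φ.op) '' {φ | lip φ ≤ 1 ∧ ‖φ.op‖ ≤ R}) := by
  refine totallyBounded_image_of_approx fun ε hε => ?_
  -- Differences satisfy `L ≤ 2`. Tail `2/N`, grid error `2N·(2 + c)·2/M` and sample error
  -- `2N·ε/(6N)` account for `ε/3` each.
  obtain ⟨N, hN⟩ := exists_nat_gt (6 / ε)
  have hN0 : (0 : ℝ) < N := (by positivity : 0 < 6 / ε).trans hN
  obtain ⟨M, hM⟩ := exists_nat_gt (2 * N * ((2 + c) * 2) * 3 / ε)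
  have hM0 : (0 : ℝ) < M := lt_of_le_of_lt (by positivity) hM
  have hN' : N ≠ 0 := by rintro rfl; simp at hN0
  have hM' : M ≠ 0 := by rintro rfl; simp at hM0
  refine ⟨Finset.Ioo (-N : ℤ) N × Fin (M + 1) × Fin (M + 1), inferInstance,
    fun φ k => φ.fn ((k.2.1 : ℝ) / M) (((k.2.2 : ℝ) / M : ℝ) : UnitAddCircle) k.1,
    ε / (6 * N), by positivity, ?_, fun φ hφ ψ hψ hd => ?_⟩
  · refine isBounded_iff_forall_norm_le.2 ⟨max 0 (R + 7), ?_⟩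
    rintro _ ⟨φ, ⟨h1, h2⟩, rfl⟩
    refine (pi_norm_le_iff_of_nonneg (le_max_left _ _)).2 fun k => ?_
    exact (norm_fn_le φ _ _ _).trans (le_max_of_le_right (by linarith))
  · have hlip : lip (φ - ψ) ≤ 2 := (lip_sub_le φ ψ).trans (by linarith [hφ.1, hψ.1])
    have hgrid : ∀ p ∈ Finset.Ioo (-N : ℤ) N, ∀ x y,
        ‖(φ - ψ).fn x y p‖ ≤ ε / (6 * N) + (2 + c) * 2 / M := by
      intro p hp x y
      refine (norm_fn_le_of_grid (φ - ψ) hM' (η := ε / (6 * N)) (fun i j => ?_) x y).trans ?_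
      · have := (dist_le_pi_dist _ _ (⟨p, hp⟩, i, j)).trans hd.le
        rw [dist_eq_norm] at this
        exact this
      · gcongr
    have h1 := norm_op_le (φ - ψ) hN' (by positivity) hgrid
    rw [SA.op_sub] at h1
    rw [dist_eq_norm]
    refine h1.trans_lt ?_
    have h2 : lip (φ - ψ) / N < ε / 3 := by
      refine ((div_le_div_iff_of_pos_right hN0).2 hlip).trans_lt ?_
      rw [div_lt_iff₀ hε] at hN
      rw [div_lt_div_iff₀ hN0 (by norm_num)]
      linarith
    have h3 : 2 * N * ((2 + c) * 2 / M) < ε / 3 := by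
      rw [div_lt_iff₀ hε] at hM
      rw [← mul_div_assoc, div_lt_div_iff₀ hM0 (by norm_num)]
      linarith
    have h4 : 2 * N * (ε / (6 * N)) = ε / 3 := by field_simp; norm_num
    rw [mul_add]
    linarith

end QHM

theorem mainTheorem2 (c : ℕ) (hc : 0 < c) (ħ μ ν : ℝ) (hμν : μ ^ 2 + ν ^ 2 ≠ 0) :
    IsOrderUnitSpace (QHM.SA.one c ħ μ ν) ∧
    (∀ φ : QHM.SA c ħ μ ν, QHM.lipE φ ≠ ⊤) ∧
    IsLipNorm (QHM.SA.one c ħ μ ν) (QHM.lip (c := c) (ħ := ħ) (μ := μ) (ν := ν)) ∧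
    TotallyBounded
      ((fun φ : QHM.SA c ħ μ ν => φ.op) '' {φ | QHM.lip φ ≤ 1 ∧ ‖φ.op‖ ≤ 1}) := by
  refine ⟨QHM.SA.isOrderUnitSpace, QHM.lipE_ne_top, ?_, QHM.totallyBounded_lip_ball 1⟩
  -- `R = 5` is the radius modulo scalars given by `norm_op_sub_le` when `L ≤ 1`.
  exact isLipNorm_of_totallyBounded (QHM.SA.opₗ c ħ μ ν) (fun _ => ENNReal.toReal_nonneg)
    QHM.lip_add_le QHM.lip_smul QHM.lip_eq_zero_iff QHM.SA.abs_state_le (R := 5)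
    (fun φ hφ => ⟨_, (QHM.norm_op_sub_le φ).trans (by linarith)⟩) (QHM.totallyBounded_lip_ball 5)
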